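/- **Setting.** A class-probability-estimation (CPE) loss is a function $\ell(y,\hat y)$, $y\in\{0,1\}$, $\hat y\in(0,1)$, with real values. Let $P_r$ be a probability measure on $\{x\in\mathbb R^d:\|x\|_2\le B_x\}$ and $P_Z$ one on $\{z\in\mathbb R^p:\|z\|_2\le B_z\}$. With $\sigma(t)=1/(1+e^{-t})$ and $k,l\ge 1$, the discriminators and generators are the neural networks $$D_\omega(x)=\sigma\big(w_k^{\mathsf T}r_{k-1}(W_{k-1}r_{k-2}(\cdots r_1(W_1x)))\big),\qquad G_\theta(z)=V_l\,s_{l-1}(V_{l-1}s_{l-2}(\cdots s_1(V_1z))),$$ where the entrywise activations $r_i,s_j$ are positively homogeneous and $R_i$-, respectively $S_j$-Lipschitz. $\Omega$ is the set of all $\omega=(W_1,\dots,W_{k-1},w_k)$ with $\|W_i\|_F\le M_i$, $\|w_k\|_2\le M_k$, and $\Theta$ the set of all $\theta=(V_1,\dots,V_l)$ with $\|V_j\|_F\le N_j$. Put $$Q_x=\Big(M_k\prod_{i=1}^{k-1}M_iR_i\Big)B_x,\qquad Q_z=\Big(M_k\prod_{i=1}^{k-1}M_iR_i\Big)\Big(N_l\prod_{j=1}^{l-1}N_jS_j\Big)B_z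 .$$ Let $P_{G_\theta}$ be the law of $G_\theta(Z)$, $Z\sim P_Z$. For CPE losses $\ell_D,\ell_G$ put $\phi=-\ell_G(1,\cdot)$, $\psi=-\ell_G(0,\cdot)$ and $$d_\omega(P,Q)=\mathbb E_{X\sim P}[\phi(D_\omega(X))]+\mathbb E_{X\sim Q}[\psi(D_\omega(X))].$$ Suppose that for every $\theta\in\Theta$ an optimal discriminator $\omega^*(\theta)=\omega^*(P_r,P_{G_\theta})\in\arg\max_{\omega\in\Omega}\big(\mathbb E_{X\sim P_r}[-\ell_D(1,D_\omega(X))]+\mathbb E_{X\sim P_{G_\theta}}[-\ell_D(0,D_\omega(X))]\big)$ exists, and fix any choice of it. Given samples $X_1,\dots,X_n$ and $Z_1,\dots,Z_m$ ($n,m\ge1$) in the above balls, let $\hat P_r$ be the empirical measure of the $X_i$ and $\hat P_{G_\theta}$ that of the $G_\theta(Z_j)$; let $\hat\theta^*$ denote any minimizer over $\Theta$ of $\theta\mapsto d_{\omega^*(\theta)}(\hat P_r,\hat P_{G_\theta})$. Its estimation error is $$\mathcal E(\hat\theta^*)=d_{\omega^*(\hat\theta^*)}(P_r,P_{G_{\hat\theta^*}})-\inf_{\theta\in\Theta}d_{\omega^*(\theta)}(P_r,P_{G_\theta}).$$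 **Theorem.** 1. If $\ell_G(0,\cdot)$ and $\ell_G(1,\cdot)$ are continuous on $(0,1)$, then for all samples in the balls and every $\hat\theta^*$, $$\mathcal E(\hat\theta^*)\le 2\sup_{\omega\in\Omega}\Big|\mathbb E_{X\sim P_r}\phi(D_\omega(X))-\frac1n\sum_{i=1}^n\phi(D_\omega(X_i))\Big|+2\sup_{\omega\in\Omega,\theta\in\Theta}\Big|\mathbb E_{Z\sim P_Z}\psi(D_\omega(G_\theta(Z)))-\frac1m\sum_{j=1}^m\psi(D_\omega(G_\theta(Z_j)))\Big| .$$ For the remaining parts, let $X_1,\dots,X_n$ be i.i.d. with law $P_r$ and $Z_1,\dots,Z_m$ i.i.d. with law $P_Z$, and let $\delta\in(0,1)$. 2. If $\phi$ and $\psi$ are $L_\phi$- and $L_\psi$-Lipschitz on $(0,1)$, then each of the following two bounds holds for all minimizers $\hat\theta^*$ with probability at least $1-2\delta$ over the samples (i.e. the exceptional event has outer probability at most $2\delta$): $$\mathcal E(\hat\theta^*)\le 4\mathcal R_{S_x}+4\mathcal R_{S_z}+\sqrt{\log\tfrac1\delta}\Big(\frac{L_\phi Q_x}{\sqrt{2n}}+\frac{L_\psi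 Q_z}{\sqrt{2m}}\Big),$$ $$\mathcal E(\hat\theta^*)\le\frac{L_\phi Q_x\sqrt{3k}}{\sqrt n}+\frac{L_\psi Q_z\sqrt{3(k+l-1)}}{\sqrt m}+\sqrt{\log\tfrac1\delta}\Big(\frac{L_\phi Q_x}{\sqrt{2n}}+\frac{L_\psi Q_z}{\sqrt{2m}}\Big).$$ Here, with independent uniform signs $\epsilon_i\in\{-1,1\}$ that are independent of the samples, $\mathcal R_{S_x}=\mathbb E\sup_{\omega\in\Omega}\big|\frac1n\sum_{i=1}^n\epsilon_i\phi(D_\omega(X_i))\big|$ and $\mathcal R_{S_z}=\mathbb E\sup_{\omega\in\Omega,\theta\in\Theta}\big|\frac1m\sum_{j=1}^m\epsilon_j\psi(D_\omega(G_\theta(Z_j)))\big|$ are Rademacher complexities. 3. ($(\alpha_D,\alpha_G)$-GANs.) For $\alpha\in(0,\infty]$ let $\ell_\alpha(1,p)=\frac{\alpha}{\alpha-1}\big(1-p^{\frac{\alpha-1}{\alpha}}\big)$ and $\ell_\alpha(0,p)=\ell_\alpha(1,1-p)$, with the limits $\ell_1(1,p)=-\log p$ and $\ell_\infty(1,p)=1-p$.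 Let $$C_h(\alpha)=\begin{cases}\sigma(h)\,\sigma(-h)^{\frac{\alpha-1}{\alpha}},&0<\alpha\le1,\\ \big(\frac{\alpha-1}{2\alpha-1}\big)^{\frac{\alpha-1}{\alpha}}\frac{\alpha}{2\alpha-1},&1<\alpha<\infty,\\ \frac14,&\alpha=\infty.\end{cases}$$ If $\ell_D=\ell_{\alpha_D}$ and $\ell_G=\ell_{\alpha_G}$ with $\alpha_D,\alpha_G\in(0,\infty]$, then with probability at least $1-2\delta$, for all minimizers $\hat\theta^*$, $$\mathcal E(\hat\theta^*)\le\frac{4C_{Q_x}(\alpha_G)Q_x\sqrt{3k}}{\sqrt n}+\frac{4C_{Q_z}(\alpha_G)Q_z\sqrt{3(k+l-1)}}{\sqrt m}+2\sqrt{2\log\tfrac1\delta}\Big(\frac{C_{Q_x}(\alpha_G)Q_x}{\sqrt n}+\frac{C_{Q_z}(\alpha_G)Q_z}{\sqrt m}\Big).$$ -/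

import Mathlib

open MeasureTheory ProbabilityTheory
open scoped NNReal ENNReal

namespace DualGAN

/-- Frobenius norm of a real matrix. -/
noncomputable def frobNorm {a b : ℕ} (A : Matrix (Fin a) (Fin b) ℝ) : ℝ :=
  letI := Matrix.frobeniusNormedAddCommGroup (m := Fin a) (n := Fin b) (α := ℝ)
  ‖A‖

/-- The linear layer `x ↦ A x` between Euclidean spaces. -/
noncomputable def linLayer {a b : ℕ} (A : Matrix (Fin b) (Fin a) ℝ)
    (x : EuclideanSpace ℝ (Fin a)) : EuclideanSpace ℝ (Fin b) :=
  WithLp.toLp 2 (A.mulVec (WithLp.ofLp x))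

/-- The activation `ρ` applied to every coordinate. -/
noncomputable def entrywise {b : ℕ} (ρ : ℝ → ℝ) (x : EuclideanSpace ℝ (Fin b)) :
    EuclideanSpace ℝ (Fin b) :=
  WithLp.toLp 2 (fun j => ρ (x j))

/-- Output of the `i`-th hidden layer of a network with `K` hidden layers, widths `a` (`a 0` is the
input dimension), weight matrices `W` and activations `ρ`:
`h₀ = x` and `hᵢ₊₁ = ρᵢ (Wᵢ hᵢ)`. -/
noncomputable def hidden {K : ℕ} (a : ℕ → ℕ) (ρ : Fin K → ℝ → ℝ)
    (W : ∀ i : Fin K, Matrix (Fin (a (i + 1))) (Fin (a i)) ℝ)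
    (x : EuclideanSpace ℝ (Fin (a 0))) : ∀ i : ℕ, i ≤ K → EuclideanSpace ℝ (Fin (a i))
  | 0, _ => x
  | i + 1, h =>
      entrywise (ρ ⟨i, h⟩) (linLayer (W ⟨i, h⟩) (hidden a ρ W x i (Nat.le_of_succ_le h)))

/-- The architectures of the two networks. The discriminator has `k = K + 1` layers (`K` hidden
ones), the generator has `l = L + 1` layers (`L` hidden ones). `r`, `s` are the activation
functions, `R`, `S` their Lipschitz constants, and `M`, `Mout`, `N`, `Nout` the norm bounds on the
parameters. The data space is `ℝ ^ (dimD 0)`, the latent space is `ℝ ^ (dimG 0)`. -/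
structure Arch where
  K : ℕ
  L : ℕ
  dimD : ℕ → ℕ
  dimG : ℕ → ℕ
  r : Fin K → ℝ → ℝ
  s : Fin L → ℝ → ℝ
  R : Fin K → ℝ≥0
  S : Fin L → ℝ≥0
  M : Fin K → ℝ≥0
  Mout : ℝ≥0
  N : Fin L → ℝ≥0
  Nout : ℝ≥0
  r_lipschitz : ∀ i, LipschitzWith (R i) (r i)
  s_lipschitz : ∀ j, LipschitzWith (S j) (s j)
  r_posHom : ∀ i, ∀ c : ℝ, 0 ≤ c → ∀ p : ℝ, r i (c * p) = c * r i p
  s_posHom : ∀ j, ∀ c : ℝ, 0 ≤ c → ∀ p : ℝ, s j (c * p) = c * s j p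

namespace Arch

variable (A : Arch)

/-- The data space. -/
abbrev Data : Type := EuclideanSpace ℝ (Fin (A.dimD 0))

/-- The latent space. -/
abbrev Latent : Type := EuclideanSpace ℝ (Fin (A.dimG 0))

/-- Discriminator parameters `(W₁, …, W_{k-1}, w_k)`. -/
structure DParam where
  W : ∀ i : Fin A.K, Matrix (Fin (A.dimD (i + 1))) (Fin (A.dimD i)) ℝ
  w : EuclideanSpace ℝ (Fin (A.dimD A.K))

/-- Generator parameters `(V₁, …, V_{l-1}, V_l)`. -/
structure GParam where
  V : ∀ j : Fin A.L, Matrix (Fin (A.dimG (j + 1))) (Fin (A.dimG j)) ℝ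
  Vout : Matrix (Fin (A.dimD 0)) (Fin (A.dimG A.L)) ℝ

/-- The parameter set `Ω` of the discriminator. -/
def discSet : Set A.DParam :=
  {ω | (∀ i, frobNorm (ω.W i) ≤ A.M i) ∧ ‖ω.w‖ ≤ A.Mout}

/-- The parameter set `Θ` of the generator. -/
def genSet : Set A.GParam :=
  {θ | (∀ j, frobNorm (θ.V j) ≤ A.N j) ∧ frobNorm θ.Vout ≤ A.Nout}

variable {A}

/-- The discriminator `D_ω(x) = σ(w_kᵀ r_{k-1}(W_{k-1} ⋯ r₁(W₁ x)))`. -/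
noncomputable def disc (ω : A.DParam) (x : A.Data) : ℝ :=
  Real.sigmoid (inner ℝ ω.w (hidden A.dimD A.r ω.W x A.K le_rfl))

/-- The generator `G_θ(z) = V_l s_{l-1}(V_{l-1} ⋯ s₁(V₁ z))`. -/
noncomputable def gen (θ : A.GParam) (z : A.Latent) : A.Data :=
  linLayer θ.Vout (hidden A.dimG A.s θ.V z A.L le_rfl)

/-- The law `P_{G_θ}` of `G_θ(Z)` for `Z` of law `PZ`. -/
noncomputable def genLaw (PZ : Measure A.Latent) (θ : A.GParam) : Measure A.Data :=
  PZ.map (gen θ)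

/-- The value function `E_{X∼P}[-ℓ(1, D_ω(X))] + E_{X∼Q}[-ℓ(0, D_ω(X))]` of the CPE loss `ℓ`. -/
noncomputable def value (ℓ : Fin 2 → ℝ → ℝ) (ω : A.DParam) (P Q : Measure A.Data) : ℝ :=
  (∫ x, -ℓ 1 (disc ω x) ∂P) + ∫ x, -ℓ 0 (disc ω x) ∂Q

/-- `ωs θ` is an optimal discriminator `ω*(P_r, P_{G_θ})` for the loss `ℓD`,
for every generator parameter `θ ∈ Θ`. -/
def IsOptimalDisc (ℓD : Fin 2 → ℝ → ℝ) (Pr : Measure A.Data) (PZ : Measure A.Latent)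
    (ωs : A.GParam → A.DParam) : Prop :=
  ∀ θ ∈ A.genSet, ωs θ ∈ A.discSet ∧
    IsMaxOn (fun ω => value ℓD ω Pr (genLaw PZ θ)) A.discSet (ωs θ)

variable (A) in
/-- `Q_x = M_k ∏ (M_i R_i) B_x`. -/
noncomputable def Qx (Bx : ℝ) : ℝ := (A.Mout * ∏ i, (A.M i * A.R i : ℝ)) * Bx

variable (A) in
/-- `Q_z = (M_k ∏ (M_i R_i)) (N_l ∏ (N_j S_j)) B_z`. -/
noncomputable def Qz (Bz : ℝ) : ℝ :=
  (A.Mout * ∏ i, (A.M i * A.R i : ℝ)) * (A.Nout * ∏ j, (A.N j * A.S j : ℝ)) * Bz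

end Arch

open Arch

/-- The empirical measure of a finite sample. -/
noncomputable def empirical {E : Type*} [MeasurableSpace E] {n : ℕ} (x : Fin n → E) : Measure E :=
  (n : ℝ≥0∞)⁻¹ • ∑ i, Measure.dirac (x i)

/-- `θ` minimizes over `Θ` the generator's objective on the samples,
`θ ↦ d_{ω*(P_r, P_{G_θ})}(P̂_r, P̂_{G_θ})`. -/
def IsTrainedGen {A : Arch} (ℓG : Fin 2 → ℝ → ℝ) (ωs : A.GParam → A.DParam) {n m : ℕ}
    (x : Fin n → A.Data) (z : Fin m → A.Latent) (θ : A.GParam) : Prop :=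
  θ ∈ A.genSet ∧
    IsMinOn (fun θ' => value ℓG (ωs θ') (empirical x) (genLaw (empirical z) θ')) A.genSet θ

/-- The estimation error of the generator parameter `θ`:
`d_{ω*(P_r, P_{G_θ})}(P_r, P_{G_θ}) - inf_{θ'} d_{ω*(P_r, P_{G_θ'})}(P_r, P_{G_θ'})`. -/
noncomputable def estError {A : Arch} (ℓG : Fin 2 → ℝ → ℝ) (ωs : A.GParam → A.DParam)
    (Pr : Measure A.Data) (PZ : Measure A.Latent) (θ : A.GParam) : ℝ :=
  value ℓG (ωs θ) Pr (genLaw PZ θ)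
    - ⨅ θ' : A.genSet, value ℓG (ωs θ') Pr (genLaw PZ θ')

/-- Uniform deviation `sup_g |E_{Y∼P} g(Y) - (1/n) ∑ g(y_j)|` of a family of functions. -/
noncomputable def uniformDev {E ι : Type*} [MeasurableSpace E] (P : Measure E)
    (g : ι → E → ℝ) {n : ℕ} (y : Fin n → E) : ℝ :=
  ⨆ i, |(∫ e, g i e ∂P) - (1 / (n : ℝ)) * ∑ j, g i (y j)|

/-- Rademacher complexity `E_{Y,ε} sup_g |(1/n) ∑ ε_j g(Y_j)|`, where `Y₁, …, Y_n` are i.i.d. of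
law `P` and the signs `ε` are independent and uniform (average over the `2 ^ n` sign vectors). -/
noncomputable def rademacher {E ι : Type*} [MeasurableSpace E] (P : Measure E)
    (g : ι → E → ℝ) (n : ℕ) : ℝ :=
  ∫ y, (1 / (2 : ℝ) ^ n) * ∑ ε : Fin n → ℤˣ,
      ⨆ i, |(1 / (n : ℝ)) * ∑ j, ((ε j : ℤ) : ℝ) * g i (y j)|
    ∂(Measure.pi fun _ : Fin n => P)

/-- The functions `x ↦ φ(D_ω(x))` on the data space, `ω ∈ Ω`. -/
noncomputable def discFamily (A : Arch) (φ : ℝ → ℝ) : A.discSet → A.Data → ℝ :=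
  fun ω x => φ (disc ω.1 x)

/-- The functions `z ↦ ψ(D_ω(G_θ(z)))` on the latent space, `(ω, θ) ∈ Ω × Θ`. -/
noncomputable def discGenFamily (A : Arch) (ψ : ℝ → ℝ) :
    A.discSet × A.genSet → A.Latent → ℝ :=
  fun q z => ψ (disc q.1.1 (gen q.2.1 z))

/-- `ℓ_α(1, ·)`: `α/(α-1) (1 - p^((α-1)/α))`, with the limits `-log p` at `α = 1` and `1 - p` at
`α = ∞`. -/
noncomputable def alphaLossOne (α : ℝ≥0∞) (p : ℝ) : ℝ :=
  if α = ⊤ then 1 - p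
  else if α = 1 then -Real.log p
  else α.toReal / (α.toReal - 1) * (1 - p ^ ((α.toReal - 1) / α.toReal))

/-- The `α`-loss: `ℓ_α(1, p)` as above, and `ℓ_α(0, p) = ℓ_α(1, 1 - p)`. -/
noncomputable def alphaLoss (α : ℝ≥0∞) : Fin 2 → ℝ → ℝ :=
  fun y p => alphaLossOne α (if y = 1 then p else 1 - p)

/-- The constant `C_h(α)`: `σ(h) σ(-h)^((α-1)/α)` for `α ≤ 1`,
`((α-1)/(2α-1))^((α-1)/α) α/(2α-1)` for `1 < α < ∞`, and the limit `1/4` for `α = ∞`. -/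
noncomputable def clipConst (α : ℝ≥0∞) (h : ℝ) : ℝ :=
  if α = ⊤ then 1 / 4
  else if α ≤ 1 then
    Real.sigmoid h * Real.sigmoid (-h) ^ ((α.toReal - 1) / α.toReal)
  else
    ((α.toReal - 1) / (2 * α.toReal - 1)) ^ ((α.toReal - 1) / α.toReal)
      * (α.toReal / (2 * α.toReal - 1))

/-- For random samples `X`, `Z` on `(S, μ)`, with probability at least `1 - p` every trained
generator parameter has estimation error at most `b`. The exceptional set need not be measurable,
so the claim is that its outer measure is at most `p`. -/
def ErrorBoundWithFailure {A : Arch} {S : Type*} [MeasurableSpace S] (μ : Measure S)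
    (ℓG : Fin 2 → ℝ → ℝ) (ωs : A.GParam → A.DParam)
    (Pr : Measure A.Data) (PZ : Measure A.Latent) {n m : ℕ}
    (X : Fin n → S → A.Data) (Z : Fin m → S → A.Latent) (p b : ℝ) : Prop :=
  μ {t | ∃ θ, IsTrainedGen ℓG ωs (fun i => X i t) (fun j => Z j t) θ ∧
      b < estError ℓG ωs Pr PZ θ} ≤ ENNReal.ofReal p

end DualGAN

/-!
A minimizer of the empirical objective is, for the true objective, optimal up to twice the largest
gap between the two objectives, and this gap is at most a uniform deviation of the data sample plus
one of the latent sample. Changing one sample point moves a uniform deviation by `O(1 / n)`, so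
McDiarmid's inequality concentrates it around its mean, and symmetrization bounds the mean by twice
a Rademacher complexity.

The complexity of the networks is estimated through exponential moments of Rademacher sums.
Positive homogeneity bounds the supremum over a layer's weight matrix by the one over a single
neuron, and the contraction principle then removes the activation, so each layer costs a factor two
inside the expectation; after the logarithm, `k` layers cost only `√k`. Composing a loss with the
sigmoid multiplies its Lipschitz constant by `1 / 4`, while the `α`-losses, which need not be
Lipschitz on `(0, 1)`, have Lipschitz constant `C_h(α)` as functions of the score on `[-h, h]`.
-/

namespace DualGAN

section Convexity

lemma convexOn_add_le_add_of_mem_segment {E : Type*} [AddCommGroup E] [Module ℝ E] {s : Set E}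
    {f : E → ℝ} (hf : ConvexOn ℝ s f) {a b x y : E} (ha : a ∈ s) (hb : b ∈ s)
    (hx : x ∈ segment ℝ a b) (hxy : x + y = a + b) : f x + f y ≤ f a + f b := by
  obtain ⟨u, v, hu, hv, huv, rfl⟩ := hx
  obtain rfl : y = v • a + u • b := by
    rw [← add_left_cancel_iff, hxy, add_add_add_comm, ← add_smul, add_comm (v • b), ← add_smul,
      huv, one_smul, one_smul]
  calc f (u • a + v • b) + f (v • a + u • b)
      ≤ (u • f a + v • f b) + (v • f a + u • f b) :=
        add_le_add (hf.2 ha hb hu hv huv) (hf.2 ha hb hv hu (by rwa [add_comm]))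
    _ = f a + f b := by
      simp only [smul_eq_mul]
      linear_combination (f a + f b) * huv

lemma convexOn_add_le_add_of_monotone {f : ℝ → ℝ} (hf : ConvexOn ℝ Set.univ f)
    (hmono : Monotone f) {x y a b : ℝ} (hsum : x + y ≤ a + b) (hx : x ≤ max a b)
    (hy : y ≤ max a b) : f x + f y ≤ f a + f b := by
  wlog hba : b ≤ a generalizing a b
  · rw [add_comm (f a)]
    exact this (by rwa [add_comm b]) (by rwa [max_comm]) (by rwa [max_comm]) (le_of_not_ge hba)
  rw [max_eq_left hba] at hx hy
  rcases le_total x b with hxb | hbx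
  · rw [add_comm (f a)]
    exact add_le_add (hmono hxb) (hmono hy)
  · calc f x + f y ≤ f x + f (b + a - x) := add_le_add le_rfl (hmono (by linarith))
      _ ≤ f b + f a := convexOn_add_le_add_of_mem_segment hf (Set.mem_univ _) (Set.mem_univ _)
        (segment_eq_Icc hba ▸ ⟨hbx, hx⟩) (add_sub_cancel _ _)
      _ = f a + f b := add_comm _ _

end Convexity

section SignSum

variable {E F : Type*} [AddCommGroup E] [Module ℝ E] [AddCommGroup F] [Module ℝ F] {n : ℕ}

/-- The Rademacher sum `∑ εᵢ vᵢ` of the vectors `v` for the sign vector `ε`. -/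
def signSum (ε : Fin n → ℤˣ) (v : Fin n → E) : E :=
  ∑ i, ((ε i : ℤ) : ℝ) • v i

lemma signSum_neg (ε : Fin n → ℤˣ) (v : Fin n → E) : signSum (-ε) v = -signSum ε v := by
  simp [signSum]

lemma signSum_cons_one (ε : Fin n → ℤˣ) (v : Fin (n + 1) → E) :
    signSum (Fin.cons 1 ε : Fin (n + 1) → ℤˣ) v = v 0 + signSum ε (Fin.tail v) := by
  simp [signSum, Fin.sum_univ_succ, Fin.tail]

lemma signSum_cons_neg_one (ε : Fin n → ℤˣ) (v : Fin (n + 1) → E) :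
    signSum (Fin.cons (-1) ε : Fin (n + 1) → ℤˣ) v = -v 0 + signSum ε (Fin.tail v) := by
  simp [signSum, Fin.sum_univ_succ, Fin.tail]

lemma map_signSum (f : E →ₗ[ℝ] F) (ε : Fin n → ℤˣ) (v : Fin n → E) :
    f (signSum ε v) = signSum ε fun i => f (v i) := by
  simp [signSum]

lemma smul_signSum (c : ℝ) (ε : Fin n → ℤˣ) (v : Fin n → E) :
    c • signSum ε v = signSum ε fun i => c • v i :=
  map_signSum (LinearMap.lsmul ℝ E c) ε v

lemma mul_signSum (c : ℝ) (ε : Fin n → ℤˣ) (v : Fin n → ℝ) :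
    c * signSum ε v = signSum ε fun i => c * v i :=
  smul_signSum c ε v

lemma inner_signSum {H : Type*} [NormedAddCommGroup H] [InnerProductSpace ℝ H] (x : H)
    (ε : Fin n → ℤˣ) (v : Fin n → H) :
    inner ℝ x (signSum ε v) = signSum ε fun i => inner ℝ x (v i) :=
  map_signSum (innerₛₗ ℝ x) ε v

lemma sum_signs_succ {M : Type*} [AddCommMonoid M] (F : (Fin (n + 1) → ℤˣ) → M) :
    ∑ ε, F ε = ∑ ε : Fin n → ℤˣ, (F (Fin.cons 1 ε) + F (Fin.cons (-1) ε)) := by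
  rw [← (Fin.consEquiv fun _ : Fin (n + 1) => ℤˣ).sum_comp, Fintype.sum_prod_type, UnitsInt.univ,
    Finset.sum_pair (by decide), ← Finset.sum_add_distrib]
  rfl

end SignSum

section SignExpSum

variable {T T' : Type*} {n : ℕ}

/-- The exponential moment `∑_ε sup_t exp (f t ε)` of a process indexed by the sign vectors `ε` of
length `n`. Values in `ℝ≥0∞` keep the supremum meaningful for unbounded index sets. -/
noncomputable def signExpSum (f : T → (Fin n → ℤˣ) → ℝ) : ℝ≥0∞ :=
  ∑ ε, ⨆ t, ENNReal.ofReal (Real.exp (f t ε))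

lemma signExpSum_le_of_forall_exists_le {f : T → (Fin n → ℤˣ) → ℝ} {g : T' → (Fin n → ℤˣ) → ℝ}
    (h : ∀ t ε, ∃ t', f t ε ≤ g t' ε) : signExpSum f ≤ signExpSum g :=
  Finset.sum_le_sum fun ε _ => iSup_mono' fun t =>
    (h t ε).imp fun _ ht' => ENNReal.ofReal_le_ofReal (Real.exp_le_exp.2 ht')

lemma signExpSum_mono {f g : T → (Fin n → ℤˣ) → ℝ} (h : ∀ t ε, f t ε ≤ g t ε) :
    signExpSum f ≤ signExpSum g :=
  signExpSum_le_of_forall_exists_le fun t ε => ⟨t, h t ε⟩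

lemma signExpSum_comp_neg (f : T → (Fin n → ℤˣ) → ℝ) :
    signExpSum (fun t ε => f t (-ε)) = signExpSum f :=
  Equiv.sum_comp (Equiv.neg (Fin n → ℤˣ)) fun ε => ⨆ t, ENNReal.ofReal (Real.exp (f t ε))

lemma signExpSum_abs_le_two_mul {f : T → (Fin n → ℤˣ) → ℝ} (hf : ∀ t ε, f t (-ε) = -f t ε) :
    signExpSum (fun t ε => |f t ε|) ≤ 2 * signExpSum f := by
  calc signExpSum (fun t ε => |f t ε|)
      ≤ signExpSum f + signExpSum (fun t ε => f t (-ε)) := by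
        rw [signExpSum, signExpSum, signExpSum, ← Finset.sum_add_distrib]
        refine Finset.sum_le_sum fun ε _ => iSup_le fun t => ?_
        rcases abs_choice (f t ε) with h | h
        · rw [h]
          exact (le_iSup (fun t => ENNReal.ofReal (Real.exp (f t ε))) t).trans le_self_add
        · rw [h, ← hf]
          exact (le_iSup (fun t => ENNReal.ofReal (Real.exp (f t (-ε)))) t).trans le_add_self
    _ = 2 * signExpSum f := by rw [signExpSum_comp_neg, two_mul]

lemma ofReal_exp_max_le_iSup (f : T → ℝ) (t s : T) :
    ENNReal.ofReal (Real.exp (max (f t) (f s))) ≤ ⨆ t, ENNReal.ofReal (Real.exp (f t)) := by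
  rw [Real.exp_monotone.map_max, ENNReal.ofReal_mono.map_max]
  exact max_le (le_iSup (fun t => ENNReal.ofReal (Real.exp (f t))) t)
    (le_iSup (fun t => ENNReal.ofReal (Real.exp (f t))) s)

lemma iSup_exp_add_add_iSup_exp_sub_le_of_contraction (a h b : T → ℝ)
    (hlip : ∀ t s, |h t - h s| ≤ |b t - b s|) (h0 : ∀ t, |h t| ≤ |b t|) :
    (⨆ t, ENNReal.ofReal (Real.exp (a t + h t))) + (⨆ t, ENNReal.ofReal (Real.exp (a t - h t)))
      ≤ (⨆ t, ENNReal.ofReal (Real.exp (a t + b t)))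
        + ⨆ t, ENNReal.ofReal (Real.exp (a t - b t)) := by
  rcases isEmpty_or_nonempty T with hT | hT
  · simp
  refine ENNReal.iSup_add_iSup_le fun t s => ?_
  refine le_trans ?_ (add_le_add (ofReal_exp_max_le_iSup (fun t => a t + b t) t s)
    (ofReal_exp_max_le_iSup (fun t => a t - b t) t s))
  rw [← ENNReal.ofReal_add (Real.exp_pos _).le (Real.exp_pos _).le,
    ← ENNReal.ofReal_add (Real.exp_pos _).le (Real.exp_pos _).le]
  refine ENNReal.ofReal_le_ofReal
    (convexOn_add_le_add_of_monotone convexOn_exp Real.exp_monotone ?_ ?_ ?_)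
  · have hts := (le_abs_self _).trans (hlip t s)
    have := le_max_left (a t + b t) (a s + b s)
    have := le_max_right (a t + b t) (a s + b s)
    have := le_max_left (a t - b t) (a s - b s)
    have := le_max_right (a t - b t) (a s - b s)
    rcases abs_cases (b t - b s) with ⟨hb, -⟩ | ⟨hb, -⟩ <;> linarith
  · have ht := (le_abs_self _).trans (h0 t)
    rcases abs_cases (b t) with ⟨hb, -⟩ | ⟨hb, -⟩
    · exact le_max_of_le_left (le_max_of_le_left (by linarith))
    · exact le_max_of_le_right (le_max_of_le_left (by linarith))
  · have hs := (neg_le_abs _).trans (h0 s)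
    rcases abs_cases (b s) with ⟨hb, -⟩ | ⟨hb, -⟩
    · exact le_max_of_le_left (le_max_of_le_right (by linarith))
    · exact le_max_of_le_right (le_max_of_le_right (by linarith))

lemma signExpSum_add_signSum_le_of_contraction (a : T → ℝ) (h b : T → Fin n → ℝ)
    (hlip : ∀ t s i, |h t i - h s i| ≤ |b t i - b s i|) (h0 : ∀ t i, |h t i| ≤ |b t i|) :
    signExpSum (fun t ε => a t + signSum ε (h t)) ≤
      signExpSum fun t ε => a t + signSum ε (b t) := by
  induction n generalizing a with
  | zero => simp [signSum]
  | succ n ih =>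
    have tail_le (c : T → ℝ) :
        signExpSum (fun t ε => c t + signSum ε (Fin.tail (h t))) ≤
          signExpSum fun t ε => c t + signSum ε (Fin.tail (b t)) :=
      ih c _ _ (fun t s i => hlip t s i.succ) fun t i => h0 t i.succ
    have head_le (ε : Fin n → ℤˣ) := iSup_exp_add_add_iSup_exp_sub_le_of_contraction
      (fun t => a t + signSum ε (Fin.tail (h t))) (fun t => h t 0) (fun t => b t 0)
      (fun t s => hlip t s 0) fun t => h0 t 0
    have tails_le := add_le_add (tail_le fun t => a t + b t 0) (tail_le fun t => a t - b t 0)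
    simp only [signExpSum, ← Finset.sum_add_distrib, sum_signs_succ, signSum_cons_one,
      signSum_cons_neg_one, ← add_assoc, ← sub_eq_add_neg] at tails_le ⊢
    refine le_trans (Finset.sum_le_sum fun ε _ => ?_) tails_le
    simpa only [add_right_comm, sub_add_eq_add_sub] using head_le ε

lemma signExpSum_abs_signSum_comp_le {ρ : ℝ → ℝ} {R : ℝ≥0} (hρ : LipschitzWith R ρ)
    (h0 : ρ 0 = 0) {c : ℝ} (hc : 0 ≤ c) (b : T → Fin n → ℝ) :
    signExpSum (fun t ε => c * |signSum ε fun i => ρ (b t i)|)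
      ≤ 2 * signExpSum fun t ε => c * R * signSum ε (b t) := by
  have hlip (p q : ℝ) : |c * ρ p - c * ρ q| ≤ |c * R * p - c * R * q| := by
    rw [← mul_sub, ← mul_sub, abs_mul, abs_mul, abs_of_nonneg (by positivity : 0 ≤ c * (R : ℝ)),
      abs_of_nonneg hc, mul_assoc]
    exact mul_le_mul_of_nonneg_left (hρ.dist_le_mul p q) hc
  calc signExpSum (fun t ε => c * |signSum ε fun i => ρ (b t i)|)
      = signExpSum fun t ε => |signSum ε fun i => c * ρ (b t i)| := by
        simp only [← mul_signSum, abs_mul, abs_of_nonneg hc]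
    _ ≤ 2 * signExpSum fun t ε => signSum ε fun i => c * ρ (b t i) :=
        signExpSum_abs_le_two_mul fun t ε => signSum_neg ε _
    _ ≤ 2 * signExpSum fun t ε => c * R * signSum ε (b t) := by
        simp only [mul_signSum (c * R)]
        gcongr
        simpa only [zero_add] using signExpSum_add_signSum_le_of_contraction (fun _ => 0)
          (fun t i => c * ρ (b t i)) (fun t i => c * R * b t i) (fun t s i => hlip _ _)
          fun t i => by simpa only [h0, mul_zero, sub_zero] using hlip (b t i) 0

end SignExpSum

section NormMoments

variable {E : Type*} [NormedAddCommGroup E] [InnerProductSpace ℝ E] {n : ℕ}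

lemma cosh_norm_add_add_cosh_norm_sub_le (x y : E) :
    Real.cosh ‖x + y‖ + Real.cosh ‖x - y‖ ≤ 2 * (Real.cosh ‖x‖ * Real.cosh ‖y‖) := by
  have hcosh : 2 * (Real.cosh ‖x‖ * Real.cosh ‖y‖)
      = Real.cosh (‖x‖ - ‖y‖) + Real.cosh (‖x‖ + ‖y‖) := by
    rw [Real.cosh_add, Real.cosh_sub]; ring
  rw [hcosh]
  -- Termwise in the power series of `cosh`: the squares of `‖x + y‖` and `‖x - y‖` lie between
  -- those of `‖x‖ - ‖y‖` and `‖x‖ + ‖y‖` and have the same sum.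
  refine hasSum_le (fun k => ?_) ((Real.hasSum_cosh _).add (Real.hasSum_cosh _))
    ((Real.hasSum_cosh _).add (Real.hasSum_cosh _))
  rw [← add_div, ← add_div]
  refine div_le_div_of_nonneg_right ?_ (by positivity)
  rw [pow_mul, pow_mul, pow_mul, pow_mul]
  have hinner := abs_le.1 (abs_real_inner_le_norm x y)
  have hadd := norm_add_sq_real x y
  have hsub := norm_sub_sq_real x y
  refine convexOn_add_le_add_of_mem_segment (convexOn_pow k) (sq_nonneg (‖x‖ - ‖y‖))
    (sq_nonneg (‖x‖ + ‖y‖)) ?_ (by linarith)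
  rw [segment_eq_Icc (by nlinarith [norm_nonneg x, norm_nonneg y])]
  constructor <;> nlinarith

lemma sum_cosh_norm_add_signSum_le (v : E) (x : Fin n → E) :
    ∑ ε, Real.cosh ‖v + signSum ε x‖ ≤ 2 ^ n * (Real.cosh ‖v‖ * ∏ i, Real.cosh ‖x i‖) := by
  induction n generalizing v with
  | zero => simp [signSum]
  | succ n ih =>
    simp only [sum_signs_succ, signSum_cons_one, signSum_cons_neg_one, ← add_assoc,
      ← sub_eq_add_neg, Finset.sum_add_distrib]
    calc _ ≤ 2 ^ n * (Real.cosh ‖v + x 0‖ * ∏ i, Real.cosh ‖Fin.tail x i‖)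
          + 2 ^ n * (Real.cosh ‖v - x 0‖ * ∏ i, Real.cosh ‖Fin.tail x i‖) :=
          add_le_add (ih _ _) (ih _ _)
      _ = 2 ^ n * ((Real.cosh ‖v + x 0‖ + Real.cosh ‖v - x 0‖)
            * ∏ i, Real.cosh ‖Fin.tail x i‖) := by ring
      _ ≤ 2 ^ n * (2 * (Real.cosh ‖v‖ * Real.cosh ‖x 0‖) * ∏ i, Real.cosh ‖Fin.tail x i‖) := by
          gcongr
          exact cosh_norm_add_add_cosh_norm_sub_le v (x 0)
      _ = 2 ^ (n + 1) * (Real.cosh ‖v‖ * ∏ i, Real.cosh ‖x i‖) := by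
          rw [Fin.prod_univ_succ, pow_succ]
          simp only [Fin.tail]
          ring

lemma sum_exp_norm_signSum_le {x : Fin n → E} {B : ℝ} (hx : ∀ i, ‖x i‖ ≤ B) :
    ∑ ε, Real.exp ‖signSum ε x‖ ≤ 2 * 2 ^ n * Real.exp (n * B ^ 2 / 2) := by
  have hexp (r : ℝ) : Real.exp r ≤ 2 * Real.cosh r := by
    rw [Real.cosh_eq]
    linarith [Real.exp_pos (-r)]
  have hcosh (i : Fin n) : Real.cosh ‖x i‖ ≤ Real.exp (B ^ 2 / 2) :=
    (Real.cosh_le_exp_half_sq _).trans (by have := hx i; gcongr)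
  calc ∑ ε, Real.exp ‖signSum ε x‖
      ≤ 2 * ∑ ε, Real.cosh ‖0 + signSum ε x‖ := by
        simp only [zero_add, Finset.mul_sum]
        exact Finset.sum_le_sum fun ε _ => hexp _
    _ ≤ 2 * (2 ^ n * (Real.cosh ‖(0 : E)‖ * ∏ i, Real.cosh ‖x i‖)) :=
        mul_le_mul_of_nonneg_left (sum_cosh_norm_add_signSum_le 0 x) two_pos.le
    _ ≤ 2 * (2 ^ n * (1 * ∏ _i : Fin n, Real.exp (B ^ 2 / 2))) := by
        rw [norm_zero, Real.cosh_zero]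
        gcongr with i
        exact hcosh i
    _ = 2 * 2 ^ n * Real.exp (n * B ^ 2 / 2) := by
        rw [Finset.prod_const, ← Real.exp_nat_mul, Finset.card_univ, Fintype.card_fin]
        ring_nf

lemma signExpSum_mul_norm_signSum_le {T : Type*} {x : Fin n → E} {B : ℝ} (hx : ∀ i, ‖x i‖ ≤ B)
    {c : ℝ} (hc : 0 ≤ c) :
    signExpSum (fun (_ : T) ε => c * ‖signSum ε x‖)
      ≤ ENNReal.ofReal (2 * 2 ^ n * Real.exp (n * (c * B) ^ 2 / 2)) := by
  have hsmul (i : Fin n) : ‖c • x i‖ ≤ c * B := by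
    rw [norm_smul, Real.norm_of_nonneg hc]
    exact mul_le_mul_of_nonneg_left (hx i) hc
  refine le_trans ?_ (ENNReal.ofReal_le_ofReal (sum_exp_norm_signSum_le hsmul))
  rw [ENNReal.ofReal_sum_of_nonneg fun _ _ => (Real.exp_pos _).le]
  refine Finset.sum_le_sum fun ε _ => iSup_le fun _ => le_of_eq ?_
  rw [← smul_signSum, norm_smul, Real.norm_of_nonneg hc]

end NormMoments

section Layer

variable {a b n : ℕ}

lemma frobNorm_nonneg (W : Matrix (Fin a) (Fin b) ℝ) : 0 ≤ frobNorm W :=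
  letI := Matrix.frobeniusNormedAddCommGroup (m := Fin a) (n := Fin b) (α := ℝ)
  norm_nonneg W

lemma frobNorm_zero : frobNorm (0 : Matrix (Fin a) (Fin b) ℝ) = 0 :=
  letI := Matrix.frobeniusNormedAddCommGroup (m := Fin a) (n := Fin b) (α := ℝ)
  norm_zero

lemma frobNorm_sq (W : Matrix (Fin a) (Fin b) ℝ) :
    frobNorm W ^ 2 = ∑ i, ‖WithLp.toLp 2 (W i)‖ ^ 2 := by
  have h : frobNorm W = (∑ i, ∑ j, ‖W i j‖ ^ (2 : ℝ)) ^ (1 / 2 : ℝ) := Matrix.frobenius_norm_def W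
  rw [h, ← Real.sqrt_eq_rpow, Real.sq_sqrt (by positivity)]
  simp [EuclideanSpace.norm_sq_eq]

lemma linLayer_apply (W : Matrix (Fin b) (Fin a) ℝ) (x : EuclideanSpace ℝ (Fin a)) (j : Fin b) :
    linLayer W x j = inner ℝ (WithLp.toLp 2 (W j)) x := by
  simp [linLayer, Matrix.mulVec, dotProduct, PiLp.inner_apply, mul_comm]

lemma norm_linLayer_le (W : Matrix (Fin b) (Fin a) ℝ) (x : EuclideanSpace ℝ (Fin a)) :
    ‖linLayer W x‖ ≤ frobNorm W * ‖x‖ := by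
  refine le_of_sq_le_sq ?_ (mul_nonneg (frobNorm_nonneg W) (norm_nonneg x))
  rw [mul_pow, frobNorm_sq, EuclideanSpace.norm_sq_eq, Finset.sum_mul]
  refine Finset.sum_le_sum fun j _ => ?_
  rw [linLayer_apply, ← mul_pow]
  exact pow_le_pow_left₀ (norm_nonneg _) (norm_inner_le_norm _ _) 2

lemma linLayer_signSum (W : Matrix (Fin b) (Fin a) ℝ) (ε : Fin n → ℤˣ)
    (v : Fin n → EuclideanSpace ℝ (Fin a)) :
    linLayer W (signSum ε v) = signSum ε fun i => linLayer W (v i) :=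
  map_signSum (Matrix.toEuclideanLin W) ε v

lemma norm_entrywise_le {ρ : ℝ → ℝ} {R : ℝ≥0} (hρ : LipschitzWith R ρ) (h0 : ρ 0 = 0)
    (x : EuclideanSpace ℝ (Fin b)) : ‖entrywise ρ x‖ ≤ R * ‖x‖ := by
  refine le_of_sq_le_sq ?_ (by positivity)
  rw [mul_pow, EuclideanSpace.norm_sq_eq, EuclideanSpace.norm_sq_eq, Finset.mul_sum]
  refine Finset.sum_le_sum fun j _ => ?_
  rw [← mul_pow]
  exact pow_le_pow_left₀ (norm_nonneg _) (hρ.norm_le_mul h0 (x j)) 2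

/-- Positive homogeneity of an activation function, as required of the activations of `Arch`. -/
def IsPosHom (ρ : ℝ → ℝ) : Prop :=
  ∀ c : ℝ, 0 ≤ c → ∀ p : ℝ, ρ (c * p) = c * ρ p

lemma IsPosHom.map_zero {ρ : ℝ → ℝ} (hρ : IsPosHom ρ) : ρ 0 = 0 := by
  simpa using hρ 0 le_rfl 0

lemma entrywise_linLayer_apply {ρ : ℝ → ℝ} (hρ : IsPosHom ρ) (W : Matrix (Fin b) (Fin a) ℝ)
    (x : EuclideanSpace ℝ (Fin a)) (j : Fin b) :
    entrywise ρ (linLayer W x) j =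
      ‖WithLp.toLp 2 (W j)‖ * ρ (inner ℝ (NormedSpace.normalize (WithLp.toLp 2 (W j))) x) := by
  rw [← hρ _ (norm_nonneg _), ← real_inner_smul_left, NormedSpace.norm_smul_normalize,
    ← linLayer_apply]
  rfl

lemma exists_norm_sum_smul_layer_le {ρ : ℝ → ℝ} (hρ : IsPosHom ρ)
    (W : Matrix (Fin b) (Fin a) ℝ) (v : Fin n → EuclideanSpace ℝ (Fin a)) (c : Fin n → ℝ) :
    ∃ u : EuclideanSpace ℝ (Fin a), ‖u‖ ≤ 1 ∧
      ‖∑ i, c i • entrywise ρ (linLayer W (v i))‖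
        ≤ frobNorm W * |∑ i, c i • ρ (inner ℝ u (v i))| := by
  set u : Fin b → EuclideanSpace ℝ (Fin a) := fun j => NormedSpace.normalize (WithLp.toLp 2 (W j))
  set s : Fin b → ℝ := fun j => ∑ i, c i • ρ (inner ℝ (u j) (v i))
  have hcoord (j : Fin b) : (∑ i, c i • entrywise ρ (linLayer W (v i))) j
      = ‖WithLp.toLp 2 (W j)‖ * s j := by
    rw [WithLp.ofLp_sum, Finset.sum_apply, Finset.mul_sum]
    refine Finset.sum_congr rfl fun i _ => ?_
    rw [PiLp.smul_apply, entrywise_linLayer_apply hρ, mul_smul_comm]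
  rcases isEmpty_or_nonempty (Fin b) with hb | hb
  · refine ⟨0, by simp, ?_⟩
    rw [Subsingleton.elim (∑ i, c i • entrywise ρ (linLayer W (v i))) 0, norm_zero]
    exact mul_nonneg (frobNorm_nonneg W) (abs_nonneg _)
  obtain ⟨j, hj⟩ := Finite.exists_max fun j => |s j|
  have hu : ‖u j‖ ≤ 1 := by
    simp only [u, NormedSpace.normalize, norm_smul, norm_inv, norm_norm]
    exact inv_mul_le_one
  refine ⟨u j, hu, le_of_sq_le_sq ?_ (mul_nonneg (frobNorm_nonneg W) (abs_nonneg _))⟩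
  calc ‖∑ i, c i • entrywise ρ (linLayer W (v i))‖ ^ 2
      = ∑ j', ‖WithLp.toLp 2 (W j')‖ ^ 2 * |s j'| ^ 2 := by
        rw [EuclideanSpace.norm_sq_eq]
        exact Finset.sum_congr rfl fun j' _ => by
          rw [hcoord, Real.norm_eq_abs, abs_mul, abs_norm, mul_pow]
    _ ≤ ∑ j', ‖WithLp.toLp 2 (W j')‖ ^ 2 * |s j| ^ 2 := by
        refine Finset.sum_le_sum fun j' _ => mul_le_mul_of_nonneg_left ?_ (sq_nonneg _)
        exact pow_le_pow_left₀ (abs_nonneg _) (hj j') 2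
    _ = (frobNorm W * |s j|) ^ 2 := by rw [← Finset.sum_mul, ← frobNorm_sq, mul_pow]

lemma signExpSum_layer_le {T : Type*} {ρ : ℝ → ℝ} {R M : ℝ≥0} (hρ : LipschitzWith R ρ)
    (hpos : IsPosHom ρ) {W : T → Matrix (Fin b) (Fin a) ℝ} (hW : ∀ t, frobNorm (W t) ≤ M)
    (v : T → Fin n → EuclideanSpace ℝ (Fin a)) {c : ℝ} (hc : 0 ≤ c) :
    signExpSum (fun t ε => c * ‖signSum ε fun i => entrywise ρ (linLayer (W t) (v t i))‖)
      ≤ 2 * signExpSum fun t ε => c * (M * R) * ‖signSum ε (v t)‖ := by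
  let U := Metric.closedBall (0 : EuclideanSpace ℝ (Fin a)) 1
  have hcMR : 0 ≤ c * M * R := by positivity
  calc signExpSum (fun t ε => c * ‖signSum ε fun i => entrywise ρ (linLayer (W t) (v t i))‖)
      ≤ signExpSum fun (q : T × U) ε =>
          c * M * |signSum ε fun i => ρ (inner ℝ q.2.1 (v q.1 i))| := by
        refine signExpSum_le_of_forall_exists_le fun t ε => ?_
        obtain ⟨u, hu, hle⟩ :=
          exists_norm_sum_smul_layer_le hpos (W t) (v t) fun i => ((ε i : ℤ) : ℝ)
        refine ⟨(t, ⟨u, mem_closedBall_zero_iff.2 hu⟩), ?_⟩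
        rw [mul_assoc]
        exact mul_le_mul_of_nonneg_left
          (hle.trans (mul_le_mul_of_nonneg_right (hW t) (abs_nonneg _))) hc
    _ ≤ 2 * signExpSum fun (q : T × U) ε =>
          c * M * R * signSum ε fun i => inner ℝ q.2.1 (v q.1 i) :=
        signExpSum_abs_signSum_comp_le hρ hpos.map_zero (by positivity) _
    _ ≤ 2 * signExpSum fun t ε => c * (M * R) * ‖signSum ε (v t)‖ := by
        gcongr
        refine signExpSum_le_of_forall_exists_le fun q ε => ⟨q.1, ?_⟩
        rw [← inner_signSum, ← mul_assoc]
        refine mul_le_mul_of_nonneg_left ((real_inner_le_norm _ _).trans ?_) hcMR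
        exact mul_le_of_le_one_left (norm_nonneg _) (mem_closedBall_zero_iff.1 q.2.2)

end Layer

section Hidden

variable {K : ℕ} {a : ℕ → ℕ} {ρ : Fin K → ℝ → ℝ} {M R : Fin K → ℝ≥0}

/-- The product `∏ⱼ Mⱼ Rⱼ` over the first `i` hidden layers, which bounds the Lipschitz constant of
`hidden … i`. -/
noncomputable def layerProd (M R : Fin K → ℝ≥0) (i : ℕ) (hi : i ≤ K) : ℝ≥0 :=
  ∏ j : Fin i, M (j.castLE hi) * R (j.castLE hi)

lemma layerProd_succ (M R : Fin K → ℝ≥0) (i : ℕ) (hi : i + 1 ≤ K) :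
    layerProd M R (i + 1) hi
      = layerProd M R i (Nat.le_of_succ_le hi) * (M ⟨i, hi⟩ * R ⟨i, hi⟩) :=
  Fin.prod_univ_castSucc _

lemma coe_layerProd_self (M R : Fin K → ℝ≥0) :
    (layerProd M R K le_rfl : ℝ) = ∏ i, (M i * R i : ℝ) := by
  simp [layerProd]

lemma norm_hidden_le (hρ : ∀ i, LipschitzWith (R i) (ρ i)) (hpos : ∀ i, IsPosHom (ρ i))
    {W : ∀ i : Fin K, Matrix (Fin (a (i + 1))) (Fin (a i)) ℝ} (hW : ∀ i, frobNorm (W i) ≤ M i)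
    (x : EuclideanSpace ℝ (Fin (a 0))) (i : ℕ) (hi : i ≤ K) :
    ‖hidden a ρ W x i hi‖ ≤ layerProd M R i hi * ‖x‖ := by
  induction i with
  | zero => simp [hidden, layerProd]
  | succ i ih =>
    have hi' : i ≤ K := Nat.le_of_succ_le hi
    calc ‖hidden a ρ W x (i + 1) hi‖
        ≤ R ⟨i, hi⟩ * ‖linLayer (W ⟨i, hi⟩) (hidden a ρ W x i hi')‖ :=
          norm_entrywise_le (hρ _) (hpos _).map_zero _
      _ ≤ R ⟨i, hi⟩ * (M ⟨i, hi⟩ * (layerProd M R i hi' * ‖x‖)) := by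
          gcongr
          exact (norm_linLayer_le _ _).trans (mul_le_mul (hW _) (ih hi') (norm_nonneg _) (by simp))
      _ = layerProd M R (i + 1) hi * ‖x‖ := by
          rw [layerProd_succ]
          push_cast
          ring

lemma signExpSum_hidden_le {T : Type*} {n : ℕ} (hρ : ∀ i, LipschitzWith (R i) (ρ i))
    (hpos : ∀ i, IsPosHom (ρ i)) {W : T → ∀ i : Fin K, Matrix (Fin (a (i + 1))) (Fin (a i)) ℝ}
    (hW : ∀ t i, frobNorm (W t i) ≤ M i) (x : T → Fin n → EuclideanSpace ℝ (Fin (a 0)))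
    (i : ℕ) (hi : i ≤ K) {c : ℝ} (hc : 0 ≤ c) :
    signExpSum (fun t ε => c * ‖signSum ε fun j => hidden a ρ (W t) (x t j) i hi‖)
      ≤ 2 ^ i * signExpSum fun t ε => c * layerProd M R i hi * ‖signSum ε (x t)‖ := by
  induction i generalizing c with
  | zero => simp [hidden, layerProd]
  | succ i ih =>
    have hi' : i ≤ K := Nat.le_of_succ_le hi
    calc signExpSum (fun t ε => c * ‖signSum ε fun j => hidden a ρ (W t) (x t j) (i + 1) hi‖)
        ≤ 2 * signExpSum fun t ε => c * (M ⟨i, hi⟩ * R ⟨i, hi⟩)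
            * ‖signSum ε fun j => hidden a ρ (W t) (x t j) i hi'‖ :=
          signExpSum_layer_le (hρ _) (hpos _) (fun t => hW t _) _ hc
      _ ≤ 2 * (2 ^ i * signExpSum fun t ε => c * (M ⟨i, hi⟩ * R ⟨i, hi⟩)
            * layerProd M R i hi' * ‖signSum ε (x t)‖) := by
          gcongr
          exact ih hi' (by positivity)
      _ = 2 ^ (i + 1) * signExpSum fun t ε =>
            c * layerProd M R (i + 1) hi * ‖signSum ε (x t)‖ := by
          rw [pow_succ', mul_assoc (2 : ℝ≥0∞), layerProd_succ, NNReal.coe_mul, NNReal.coe_mul,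
            mul_comm (layerProd M R i hi' : ℝ), mul_assoc c]

end Hidden

section EmpiricalRademacher

lemma ofReal_exp_iSup_le {T : Type*} [Nonempty T] (s : T → ℝ) :
    ENNReal.ofReal (Real.exp (⨆ t, s t)) ≤ ⨆ t, ENNReal.ofReal (Real.exp (s t)) := by
  rcases eq_or_ne (⨆ t, ENNReal.ofReal (Real.exp (s t))) ⊤ with htop | htop
  · exact htop ▸ le_top
  set r := ⨆ t, ENNReal.ofReal (Real.exp (s t))
  have hle (t : T) : Real.exp (s t) ≤ r.toReal :=
    (ENNReal.ofReal_le_iff_le_toReal htop).1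
      (le_iSup (fun t => ENNReal.ofReal (Real.exp (s t))) t)
  have hpos : 0 < r.toReal := (Real.exp_pos _).trans_le (hle (Classical.arbitrary T))
  rw [ENNReal.ofReal_le_iff_le_toReal htop, ← Real.le_log_iff_exp_le hpos]
  exact ciSup_le fun t => (Real.le_log_iff_exp_le hpos).2 (hle t)

lemma mul_average_iSup_le_of_signExpSum_le {T : Type*} [Nonempty T] {n : ℕ}
    {f : T → (Fin n → ℤˣ) → ℝ} {b c : ℝ} (hc : 0 ≤ c)
    (h : signExpSum (fun t ε => c * f t ε) ≤ ENNReal.ofReal (2 ^ n * Real.exp b)) :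
    c * ((1 / (2 : ℝ) ^ n) * ∑ ε, ⨆ t, f t ε) ≤ b := by
  have hcard : (Fintype.card (Fin n → ℤˣ) : ℝ) = 2 ^ n := by simp
  have hsum : ∑ ε, Real.exp (⨆ t, c * f t ε) ≤ 2 ^ n * Real.exp b := by
    rw [← ENNReal.ofReal_le_ofReal_iff (by positivity),
      ENNReal.ofReal_sum_of_nonneg fun _ _ => (Real.exp_pos _).le]
    exact (Finset.sum_le_sum fun ε _ => ofReal_exp_iSup_le _).trans h
  have hjensen := convexOn_exp.map_sum_le (t := Finset.univ) (w := fun _ => 1 / (2 : ℝ) ^ n)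
    (p := fun ε : Fin n → ℤˣ => ⨆ t, c * f t ε) (fun _ _ => by positivity)
    (by rw [Finset.sum_const, Finset.card_univ, nsmul_eq_mul, hcard]; field_simp) (by simp)
  simp only [smul_eq_mul, ← Finset.mul_sum] at hjensen
  rw [mul_left_comm, Finset.mul_sum, ← Real.exp_le_exp]
  simp only [Real.mul_iSup_of_nonneg hc]
  calc Real.exp (1 / 2 ^ n * ∑ ε, ⨆ t, c * f t ε)
      ≤ 1 / 2 ^ n * ∑ ε, Real.exp (⨆ t, c * f t ε) := hjensen
    _ ≤ 1 / 2 ^ n * (2 ^ n * Real.exp b) := by gcongr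
    _ = Real.exp b := by field_simp

lemma le_sqrt_of_forall_mul_le {x a b : ℝ} (hb : 0 ≤ b)
    (h : ∀ c : ℝ, 0 < c → c * x ≤ a + c ^ 2 * b / 2) : x ≤ √(2 * a * b) := by
  by_contra! hx
  have hx0 : 0 < x := (Real.sqrt_nonneg _).trans_lt hx
  have hx2 : 2 * a * b < x ^ 2 := (Real.sqrt_lt' hx0).1 hx
  rcases hb.eq_or_lt with rfl | hb
  · have hlin := h ((|a| + 1) / x) (by positivity)
    rw [div_mul_cancel₀ _ hx0.ne'] at hlin
    linarith [le_abs_self a]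
  · have hopt := h (x / b) (by positivity)
    have hquad : a + (x / b) ^ 2 * b / 2 - x / b * x = (2 * a * b - x ^ 2) / (2 * b) := by
      field_simp
      ring
    have hneg : (2 * a * b - x ^ 2) / (2 * b) < 0 :=
      div_neg_of_neg_of_pos (by linarith) (by linarith)
    linarith

variable {ι E : Type*} {n : ℕ}

/-- The supremum `sup_i |(1/n) ∑ ε_j g_i(y_j)|` for a fixed sign vector `ε`. -/
noncomputable def signDev (g : ι → E → ℝ) (ε : Fin n → ℤˣ) (y : Fin n → E) : ℝ :=
  ⨆ i, |(1 / (n : ℝ)) * signSum ε fun j => g i (y j)|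

/-- The empirical Rademacher complexity of the family `g` on the sample `y`: the average of
`signDev g ε y` over the `2 ^ n` sign vectors `ε`. -/
noncomputable def empRademacher (g : ι → E → ℝ) (y : Fin n → E) : ℝ :=
  (1 / (2 : ℝ) ^ n) * ∑ ε, signDev g ε y

lemma rademacher_eq_integral_empRademacher [MeasurableSpace E] (P : Measure E) (g : ι → E → ℝ)
    (n : ℕ) : rademacher P g n = ∫ y, empRademacher g y ∂(Measure.pi fun _ : Fin n => P) :=
  rfl

lemma empRademacher_le_of_signExpSum_le [Nonempty ι] {g : ι → E → ℝ} {y : Fin n → E} {N q : ℝ}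
    (hN : 0 < N) (hq : 0 ≤ q)
    (h : ∀ c : ℝ, 0 ≤ c → signExpSum (fun i ε => c * |signSum ε fun j => g i (y j)|)
      ≤ ENNReal.ofReal (N * 2 ^ n * Real.exp (n * (c * q) ^ 2 / 2))) :
    empRademacher g y ≤ q * √(2 * Real.log N) / √n := by
  set a : ℝ := (1 / (2 : ℝ) ^ n) * ∑ ε : Fin n → ℤˣ, ⨆ i, |signSum ε fun j => g i (y j)|
  have heq : empRademacher g y = 1 / n * a := by
    have hn : (0 : ℝ) ≤ 1 / n := by positivity
    simp only [empRademacher, signDev, abs_mul, abs_of_nonneg hn, ← Real.mul_iSup_of_nonneg hn,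
      ← Finset.mul_sum, a]
    ring
  have ha : a ≤ √(2 * Real.log N * (n * q ^ 2)) := by
    refine le_sqrt_of_forall_mul_le (by positivity) fun c hc =>
      mul_average_iSup_le_of_signExpSum_le hc.le ((h c hc.le).trans_eq ?_)
    rw [Real.exp_add, Real.exp_log hN]
    ring_nf
  rw [Real.sqrt_mul' _ (by positivity), Real.sqrt_mul (Nat.cast_nonneg n), Real.sqrt_sq hq] at ha
  calc empRademacher g y = a / n := by rw [heq]; ring
    _ ≤ √(2 * Real.log N) * (√n * q) / n := by gcongr
    _ = q * √(2 * Real.log N) * (√n / n) := by ring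
    _ = q * √(2 * Real.log N) / √n := by rw [Real.sqrt_div_self, ← div_eq_mul_inv]

lemma two_mul_log_two_pow_add_two_le (k : ℕ) :
    2 * Real.log (2 ^ (k + 2)) ≤ 3 * ((k : ℝ) + 1) := by
  rw [Real.log_pow]
  push_cast
  nlinarith [Real.log_two_lt_d9, (Nat.cast_nonneg k : (0 : ℝ) ≤ k)]

lemma empRademacher_le_of_signExpSum_le_two_pow [Nonempty ι] {g : ι → E → ℝ} {y : Fin n → E}
    (k : ℕ) {q : ℝ} (hq : 0 ≤ q)
    (h : ∀ c : ℝ, 0 ≤ c → signExpSum (fun i ε => c * |signSum ε fun j => g i (y j)|)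
      ≤ 2 ^ (k + 1) * ENNReal.ofReal (2 * 2 ^ n * Real.exp (n * (c * q) ^ 2 / 2))) :
    empRademacher g y ≤ q * √(3 * ((k : ℝ) + 1)) / √n := by
  have hbound := empRademacher_le_of_signExpSum_le (N := 2 ^ (k + 2)) (by positivity) hq
    fun c hc => (h c hc).trans_eq <| by
      rw [← ENNReal.ofReal_ofNat 2, ← ENNReal.ofReal_pow two_pos.le,
        ← ENNReal.ofReal_mul (by positivity)]
      ring_nf
  exact hbound.trans <| div_le_div_of_nonneg_right
    (mul_le_mul_of_nonneg_left (Real.sqrt_le_sqrt (two_mul_log_two_pow_add_two_le k)) hq)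
    (Real.sqrt_nonneg _)

end EmpiricalRademacher

namespace Arch

variable {A : Arch}

/-- The argument `w_kᵀ r_{k-1}(W_{k-1} ⋯ r₁(W₁ x))` of the final sigmoid of the discriminator. -/
noncomputable def preact (ω : A.DParam) (x : A.Data) : ℝ :=
  inner ℝ ω.w (hidden A.dimD A.r ω.W x A.K le_rfl)

variable (A) in
/-- The bound `M_k ∏ (M_i R_i)` on the Lipschitz constants of the functions `preact ω`. -/
noncomputable def discConst : ℝ≥0 := A.Mout * layerProd A.M A.R A.K le_rfl

variable (A) in
/-- The bound `N_l ∏ (N_j S_j)` on the Lipschitz constants of the generators. -/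
noncomputable def genConst : ℝ≥0 := A.Nout * layerProd A.N A.S A.L le_rfl

lemma Qx_eq (B : ℝ) : A.Qx B = A.discConst * B := by
  rw [Qx, discConst, NNReal.coe_mul, coe_layerProd_self]

lemma Qz_eq (B : ℝ) : A.Qz B = A.discConst * (A.genConst * B) := by
  rw [Qz, discConst, genConst, NNReal.coe_mul, NNReal.coe_mul, coe_layerProd_self,
    coe_layerProd_self, mul_assoc]

lemma Qx_nonneg {B : ℝ} (hB : 0 ≤ B) : 0 ≤ A.Qx B := by
  rw [Qx_eq]
  positivity

lemma Qz_nonneg {B : ℝ} (hB : 0 ≤ B) : 0 ≤ A.Qz B := by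
  rw [Qz_eq]
  positivity

lemma abs_preact_le {ω : A.DParam} (hω : ω ∈ A.discSet) (x : A.Data) :
    |preact ω x| ≤ A.discConst * ‖x‖ := by
  calc |preact ω x| ≤ ‖ω.w‖ * ‖hidden A.dimD A.r ω.W x A.K le_rfl‖ := abs_real_inner_le_norm _ _
    _ ≤ A.Mout * (layerProd A.M A.R A.K le_rfl * ‖x‖) := by
        gcongr
        exacts [hω.2, norm_hidden_le A.r_lipschitz A.r_posHom hω.1 x A.K le_rfl]
    _ = A.discConst * ‖x‖ := by rw [discConst, NNReal.coe_mul, mul_assoc]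

lemma norm_gen_le {θ : A.GParam} (hθ : θ ∈ A.genSet) (z : A.Latent) :
    ‖gen θ z‖ ≤ A.genConst * ‖z‖ := by
  calc ‖gen θ z‖ ≤ frobNorm θ.Vout * ‖hidden A.dimG A.s θ.V z A.L le_rfl‖ := norm_linLayer_le _ _
    _ ≤ A.Nout * (layerProd A.N A.S A.L le_rfl * ‖z‖) := by
        gcongr
        exacts [hθ.2, norm_hidden_le A.s_lipschitz A.s_posHom hθ.1 z A.L le_rfl]
    _ = A.genConst * ‖z‖ := by rw [genConst, NNReal.coe_mul, mul_assoc]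

lemma abs_preact_le_Qx {ω : A.DParam} (hω : ω ∈ A.discSet) {x : A.Data} {B : ℝ} (hx : ‖x‖ ≤ B) :
    |preact ω x| ≤ A.Qx B := by
  rw [Qx_eq]
  exact (abs_preact_le hω x).trans (by gcongr)

lemma abs_preact_gen_le_Qz {ω : A.DParam} (hω : ω ∈ A.discSet) {θ : A.GParam}
    (hθ : θ ∈ A.genSet) {z : A.Latent} {B : ℝ} (hz : ‖z‖ ≤ B) :
    |preact ω (gen θ z)| ≤ A.Qz B := by
  rw [Qz_eq]
  refine (abs_preact_le hω _).trans ?_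
  gcongr
  exact (norm_gen_le hθ z).trans (by gcongr)

instance : Nonempty A.discSet :=
  ⟨⟨⟨fun _ => 0, 0⟩, fun _ => frobNorm_zero.trans_le (NNReal.coe_nonneg _),
    norm_zero.trans_le (NNReal.coe_nonneg _)⟩⟩

instance : Nonempty A.genSet :=
  ⟨⟨⟨fun _ => 0, 0⟩, fun _ => frobNorm_zero.trans_le (NNReal.coe_nonneg _),
    frobNorm_zero.trans_le (NNReal.coe_nonneg _)⟩⟩

section RademacherBounds

variable {T : Type*} {n : ℕ} {F : ℝ → ℝ} {Λ : ℝ≥0} {c B : ℝ}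

lemma signExpSum_preact_le (hF : LipschitzWith Λ F) (hF0 : F 0 = 0) {ω : T → A.DParam}
    (hω : ∀ t, ω t ∈ A.discSet) (x : T → Fin n → A.Data) (hc : 0 ≤ c) :
    signExpSum (fun t ε => c * |signSum ε fun j => F (preact (ω t) (x t j))|)
      ≤ 2 ^ (A.K + 1) * signExpSum fun t ε => c * Λ * A.discConst * ‖signSum ε (x t)‖ := by
  calc signExpSum (fun t ε => c * |signSum ε fun j => F (preact (ω t) (x t j))|)
      ≤ 2 * signExpSum fun t ε => c * Λ * signSum ε fun j => preact (ω t) (x t j) :=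
        signExpSum_abs_signSum_comp_le hF hF0 hc _
    _ ≤ 2 * signExpSum fun t ε => c * Λ * A.Mout
          * ‖signSum ε fun j => hidden A.dimD A.r (ω t).W (x t j) A.K le_rfl‖ := by
        gcongr
        refine signExpSum_mono fun t ε => ?_
        rw [mul_assoc (c * (Λ : ℝ))]
        refine mul_le_mul_of_nonneg_left ?_ (by positivity)
        simp only [preact, ← inner_signSum]
        exact (real_inner_le_norm _ _).trans
          (mul_le_mul_of_nonneg_right (hω t).2 (norm_nonneg _))
    _ ≤ 2 * (2 ^ A.K * signExpSum fun t ε => c * Λ * A.Mout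
          * layerProd A.M A.R A.K le_rfl * ‖signSum ε (x t)‖) := by
        gcongr
        exact signExpSum_hidden_le A.r_lipschitz A.r_posHom (fun t => (hω t).1) x A.K le_rfl
          (by positivity)
    _ = 2 ^ (A.K + 1) * signExpSum fun t ε => c * Λ * A.discConst * ‖signSum ε (x t)‖ := by
        rw [pow_succ', mul_assoc (2 : ℝ≥0∞), discConst, NNReal.coe_mul,
          ← mul_assoc (c * (Λ : ℝ))]

lemma signExpSum_gen_le {θ : T → A.GParam} (hθ : ∀ t, θ t ∈ A.genSet)
    (z : T → Fin n → A.Latent) (hc : 0 ≤ c) :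
    signExpSum (fun t ε => c * ‖signSum ε fun j => gen (θ t) (z t j)‖)
      ≤ 2 ^ A.L * signExpSum fun t ε => c * A.genConst * ‖signSum ε (z t)‖ := by
  calc signExpSum (fun t ε => c * ‖signSum ε fun j => gen (θ t) (z t j)‖)
      ≤ signExpSum fun t ε => c * A.Nout
          * ‖signSum ε fun j => hidden A.dimG A.s (θ t).V (z t j) A.L le_rfl‖ := by
        refine signExpSum_mono fun t ε => ?_
        simp only [gen]
        rw [← linLayer_signSum, mul_assoc]
        refine mul_le_mul_of_nonneg_left ?_ hc
        exact (norm_linLayer_le _ _).trans (mul_le_mul_of_nonneg_right (hθ t).2 (norm_nonneg _))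
    _ ≤ 2 ^ A.L * signExpSum fun t ε => c * A.Nout * layerProd A.N A.S A.L le_rfl
          * ‖signSum ε (z t)‖ :=
        signExpSum_hidden_le A.s_lipschitz A.s_posHom (fun t => (hθ t).1) z A.L le_rfl
          (by positivity)
    _ = 2 ^ A.L * signExpSum fun t ε => c * A.genConst * ‖signSum ε (z t)‖ := by
        rw [genConst, NNReal.coe_mul, ← mul_assoc c]

lemma empRademacher_comp_preact_le (hF : LipschitzWith Λ F) (hF0 : F 0 = 0) (hB : 0 ≤ B)
    {x : Fin n → A.Data} (hx : ∀ j, ‖x j‖ ≤ B) :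
    empRademacher (fun ω : A.discSet => F ∘ preact ω.1) x
      ≤ Λ * A.Qx B * √(3 * ((A.K : ℝ) + 1)) / √n := by
  have hQ := A.Qx_nonneg hB
  refine empRademacher_le_of_signExpSum_le_two_pow A.K (by positivity) fun c hc => ?_
  calc signExpSum (fun (ω : A.discSet) ε => c * |signSum ε fun j => F (preact ω.1 (x j))|)
      ≤ 2 ^ (A.K + 1) * signExpSum fun (_ : A.discSet) ε => c * Λ * A.discConst * ‖signSum ε x‖ :=
        signExpSum_preact_le hF hF0 (fun ω => ω.2) (fun _ => x) hc
    _ ≤ 2 ^ (A.K + 1) *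
          ENNReal.ofReal (2 * 2 ^ n * Real.exp (n * (c * Λ * A.discConst * B) ^ 2 / 2)) := by
        gcongr
        exact signExpSum_mul_norm_signSum_le hx (by positivity)
    _ = 2 ^ (A.K + 1) *
          ENNReal.ofReal (2 * 2 ^ n * Real.exp (n * (c * (Λ * A.Qx B)) ^ 2 / 2)) := by
        rw [Qx_eq, mul_assoc (c * (Λ : ℝ)), mul_assoc c]

lemma empRademacher_comp_preact_gen_le (hF : LipschitzWith Λ F) (hF0 : F 0 = 0) (hB : 0 ≤ B)
    {z : Fin n → A.Latent} (hz : ∀ j, ‖z j‖ ≤ B) :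
    empRademacher (fun q : A.discSet × A.genSet => F ∘ preact q.1.1 ∘ gen q.2.1) z
      ≤ Λ * A.Qz B * √(3 * ((A.K : ℝ) + 1 + (A.L + 1) - 1)) / √n := by
  have hQ := A.Qz_nonneg hB
  rw [show (A.K : ℝ) + 1 + (A.L + 1) - 1 = ((A.K + A.L : ℕ) : ℝ) + 1 by push_cast; ring]
  refine empRademacher_le_of_signExpSum_le_two_pow (A.K + A.L) (by positivity) fun c hc => ?_
  calc signExpSum (fun (q : A.discSet × A.genSet) ε =>
          c * |signSum ε fun j => F (preact q.1.1 (gen q.2.1 (z j)))|)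
      ≤ 2 ^ (A.K + 1) * signExpSum fun (q : A.discSet × A.genSet) ε =>
          c * Λ * A.discConst * ‖signSum ε fun j => gen q.2.1 (z j)‖ :=
        signExpSum_preact_le hF hF0 (ω := fun q : A.discSet × A.genSet => q.1.1) (fun q => q.1.2)
          (fun q j => gen q.2.1 (z j)) hc
    _ ≤ 2 ^ (A.K + 1) * (2 ^ A.L * signExpSum fun (_ : A.discSet × A.genSet) ε =>
          c * Λ * A.discConst * A.genConst * ‖signSum ε z‖) := by
        gcongr
        exact signExpSum_gen_le (θ := fun q : A.discSet × A.genSet => q.2.1) (fun q => q.2.2)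
          (fun _ => z) (by positivity)
    _ ≤ 2 ^ (A.K + 1) * (2 ^ A.L * ENNReal.ofReal
          (2 * 2 ^ n * Real.exp (n * (c * Λ * A.discConst * A.genConst * B) ^ 2 / 2))) := by
        gcongr
        exact signExpSum_mul_norm_signSum_le hz (by positivity)
    _ = 2 ^ (A.K + A.L + 1) *
          ENNReal.ofReal (2 * 2 ^ n * Real.exp (n * (c * (Λ * A.Qz B)) ^ 2 / 2)) := by
        rw [← mul_assoc, ← pow_add, add_right_comm, Qz_eq]
        ring_nf

end RademacherBounds

end Arch

section BoundedDifferences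

/-- The bounded differences property of McDiarmid's inequality: changing the `i`-th coordinate of
the argument changes `f` by at most `c i`. -/
def HasBoundedDifferences {ι : Type*} [DecidableEq ι] {E : ι → Type*} (f : (∀ i, E i) → ℝ)
    (c : ι → ℝ≥0) : Prop :=
  ∀ y i e, |f (Function.update y i e) - f y| ≤ c i

namespace HasBoundedDifferences

lemma abs_sub_le_sum {ι : Type*} [DecidableEq ι] [Fintype ι] {E : ι → Type*}
    {f : (∀ i, E i) → ℝ} {c : ι → ℝ≥0} (hf : HasBoundedDifferences f c) (y y' : ∀ i, E i) :
    |f y' - f y| ≤ ∑ i, (c i : ℝ) := by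
  suffices ∀ s : Finset ι, |f (s.piecewise y' y) - f y| ≤ ∑ i ∈ s, (c i : ℝ) by
    simpa using this Finset.univ
  intro s
  induction s using Finset.induction_on with
  | empty => simp
  | insert i s hi ih =>
    rw [Finset.piecewise_insert, Finset.sum_insert hi]
    exact (abs_sub_le _ (f (s.piecewise y' y)) _).trans (add_le_add (hf _ i _) ih)

lemma integrable {ι : Type*} [DecidableEq ι] [Finite ι] {E : ι → Type*}
    [∀ i, MeasurableSpace (E i)] {f : (∀ i, E i) → ℝ} {c : ι → ℝ≥0}
    (hf : HasBoundedDifferences f c) (hfm : Measurable f) (μ : Measure (∀ i, E i))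
    [IsFiniteMeasure μ] : Integrable f μ := by
  have := Fintype.ofFinite ι
  rcases isEmpty_or_nonempty (∀ i, E i) with _ | ⟨⟨y⟩⟩
  · exact .of_isEmpty
  · refine .of_bound hfm.aestronglyMeasurable (|f y| + ∑ i, (c i : ℝ)) (ae_of_all _ fun y' => ?_)
    rw [Real.norm_eq_abs]
    linarith [hf.abs_sub_le_sum y y', abs_sub_abs_le_abs_sub (f y') (f y)]

variable {n : ℕ} {E : Fin (n + 1) → Type*} {f : (∀ i, E i) → ℝ} {c : Fin (n + 1) → ℝ≥0}

lemma insertNth (hf : HasBoundedDifferences f c) (p : Fin (n + 1)) (x : E p) :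
    HasBoundedDifferences (fun y => f (p.insertNth x y)) fun i => c (p.succAbove i) :=
  fun y i e => by
    simpa only [Fin.insertNth_update] using hf (p.insertNth x y) (p.succAbove i) e

variable [∀ i, MeasurableSpace (E i)]

lemma measurable_comp_insertNth (hfm : Measurable f) (p : Fin (n + 1)) (x : E p) :
    Measurable fun y => f (p.insertNth x y) :=
  hfm.comp ((MeasurableEquiv.piFinSuccAbove E p).symm.measurable.comp measurable_prodMk_left)

lemma integral_insertNth_sub_le (hf : HasBoundedDifferences f c) (hfm : Measurable f)
    (p : Fin (n + 1)) (π : Measure (∀ i, E (p.succAbove i))) [IsProbabilityMeasure π]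
    (x x' : E p) :
    (∫ y, f (p.insertNth x y) ∂π) - ∫ y, f (p.insertNth x' y) ∂π ≤ c p := by
  have hint (x : E p) : Integrable (fun y => f (p.insertNth x y)) π :=
    (hf.insertNth p x).integrable (measurable_comp_insertNth hfm p x) π
  rw [← integral_sub (hint x) (hint x')]
  have hle (y) : f (p.insertNth x y) - f (p.insertNth x' y) ≤ c p := by
    have := hf (p.insertNth x' y) p x
    rw [Fin.update_insertNth] at this
    exact (le_abs_self _).trans this
  simpa using integral_mono ((hint x).sub (hint x')) (integrable_const (c p : ℝ)) hle

end HasBoundedDifferences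

lemma hasSubgaussianMGF_of_sub_le {Ω : Type*} [MeasurableSpace Ω] {μ : Measure Ω}
    [IsProbabilityMeasure μ] {g : Ω → ℝ} (hg : Measurable g) {c : ℝ≥0}
    (hc : ∀ x x', g x - g x' ≤ c) :
    HasSubgaussianMGF (fun x => g x - ∫ x, g x ∂μ) ((c / 2) ^ 2) μ := by
  have hne : Nonempty Ω := μ.nonempty_of_neZero
  have hsub (x : Ω) : g x - c ≤ ⨅ x, g x := le_ciInf fun x' => by linarith [hc x x']
  have hbdd : BddBelow (Set.range g) :=
    ⟨g hne.some - c, Set.forall_mem_range.2 fun x => by linarith [hc hne.some x]⟩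
  have h := hasSubgaussianMGF_of_mem_Icc (μ := μ) (a := ⨅ x, g x) (b := (⨅ x, g x) + c)
    hg.aemeasurable (ae_of_all _ fun x => ⟨ciInf_le hbdd x, by linarith [hsub x]⟩)
  rwa [add_sub_cancel_left, NNReal.nnnorm_eq] at h

lemma hasSubgaussianMGF_fst_add {Ω Ω' : Type*} [MeasurableSpace Ω] [MeasurableSpace Ω']
    {μ : Measure Ω} {ν : Measure Ω'} [SFinite μ] [SFinite ν] {X : Ω → ℝ} {Y : Ω × Ω' → ℝ}
    {a b : ℝ≥0} (hX : HasSubgaussianMGF X a μ) (hYm : Measurable Y)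
    (hY : ∀ x, HasSubgaussianMGF (fun y => Y (x, y)) b ν) :
    HasSubgaussianMGF (fun q => X q.1 + Y q) (a + b) (μ.prod ν) := by
  have hle (t : ℝ) (x : Ω) : ∫ y, Real.exp (t * (X x + Y (x, y))) ∂ν
      ≤ Real.exp (t * X x) * Real.exp (b * t ^ 2 / 2) := by
    simp only [mul_add, Real.exp_add, integral_const_mul]
    exact mul_le_mul_of_nonneg_left ((hY x).mgf_le t) (Real.exp_pos _).le
  have hdom (t : ℝ) := (hX.integrable_exp_mul t).mul_const (Real.exp (b * t ^ 2 / 2))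
  have hint (t : ℝ) : Integrable (fun q => Real.exp (t * (X q.1 + Y q))) (μ.prod ν) := by
    have hm : AEStronglyMeasurable (fun q : Ω × Ω' => Real.exp (t * (X q.1 + Y q))) (μ.prod ν) := by
      simp only [mul_add, Real.exp_add]
      exact (hX.integrable_exp_mul t).1.comp_fst.mul (by fun_prop)
    refine (integrable_prod_iff hm).2 ⟨ae_of_all _ fun x => ?_, ?_⟩
    · simp only [mul_add, Real.exp_add]
      exact ((hY x).integrable_exp_mul t).const_mul _
    · refine (hdom t).mono' hm.norm.integral_prod_right' (ae_of_all _ fun x => ?_)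
      simp only [Real.norm_eq_abs, Real.abs_exp]
      rw [abs_of_nonneg (integral_nonneg fun _ => (Real.exp_pos _).le)]
      exact hle t x
  refine ⟨hint, fun t => ?_⟩
  calc mgf (fun q => X q.1 + Y q) (μ.prod ν) t
      = ∫ x, ∫ y, Real.exp (t * (X x + Y (x, y))) ∂ν ∂μ := integral_prod _ (hint t)
    _ ≤ ∫ x, Real.exp (t * X x) * Real.exp (b * t ^ 2 / 2) ∂μ :=
        integral_mono (hint t).integral_prod_left (hdom t) (hle t)
    _ ≤ Real.exp (a * t ^ 2 / 2) * Real.exp (b * t ^ 2 / 2) := by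
        rw [integral_mul_const]
        exact mul_le_mul_of_nonneg_right (hX.mgf_le t) (Real.exp_pos _).le
    _ = Real.exp ((a + b : ℝ≥0) * t ^ 2 / 2) := by
        rw [← Real.exp_add, NNReal.coe_add]
        ring_nf

/-- **McDiarmid's inequality**, as a sub-Gaussian bound. -/
theorem HasBoundedDifferences.hasSubgaussianMGF {n : ℕ} {E : Fin n → Type*}
    [∀ i, MeasurableSpace (E i)] (μ : ∀ i, Measure (E i)) [∀ i, IsProbabilityMeasure (μ i)]
    {f : (∀ i, E i) → ℝ} {c : Fin n → ℝ≥0} (hf : HasBoundedDifferences f c) (hfm : Measurable f) :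
    HasSubgaussianMGF (fun y => f y - ∫ y, f y ∂Measure.pi μ) (∑ i, (c i / 2) ^ 2)
      (Measure.pi μ) := by
  induction n with
  | zero =>
    have h (y) : f y - ∫ y, f y ∂Measure.pi μ = 0 := by
      simp [Subsingleton.elim (α := ∀ i, E i) _ y]
    simp [h]
  | succ n ih =>
    let e := MeasurableEquiv.piFinSuccAbove E 0
    set π := Measure.pi fun i => μ ((0 : Fin (n + 1)).succAbove i)
    have he : MeasurePreserving e (Measure.pi μ) ((μ 0).prod π) :=
      measurePreserving_piFinSuccAbove μ 0
    have hfe : Measurable fun q => f (e.symm q) := hfm.comp e.symm.measurable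
    set g : E 0 → ℝ := fun x => ∫ y, f (Fin.insertNth 0 x y) ∂π
    have hg : Measurable g := hfe.stronglyMeasurable.integral_prod_right.measurable
    have hint : ∫ y, f y ∂Measure.pi μ = ∫ x, g x ∂μ 0 := by
      rw [← he.symm.integral_comp', integral_prod]
      · rfl
      · exact he.symm.integrable_comp_of_integrable (hf.integrable hfm _)
    have hfst : HasSubgaussianMGF (fun x => g x - ∫ x, g x ∂μ 0) ((c 0 / 2) ^ 2) (μ 0) :=
      hasSubgaussianMGF_of_sub_le hg (hf.integral_insertNth_sub_le hfm 0 π)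
    have hslice (x : E 0) := ih (fun i => μ (Fin.succAbove 0 i)) (hf.insertNth 0 x)
      (measurable_comp_insertNth hfm 0 x)
    have hprod := hasSubgaussianMGF_fst_add hfst (Y := fun q => f (e.symm q) - g q.1)
      (hfe.sub (hg.comp measurable_fst)) hslice
    rw [← he.map_eq] at hprod
    convert HasSubgaussianMGF.of_map he.measurable.aemeasurable hprod using 1
    · funext y
      simp only [hint, Function.comp_apply, e.symm_apply_apply]
      ring
    · rw [Fin.sum_univ_succAbove _ 0]

lemma measure_sqrt_lt_le_of_hasSubgaussianMGF {Ω : Type*} [MeasurableSpace Ω] {μ : Measure Ω}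
    [IsFiniteMeasure μ] {X : Ω → ℝ} {v : ℝ≥0} (hX : HasSubgaussianMGF X v μ) {δ : ℝ} (hδ : 0 < δ)
    (hδ1 : δ ≤ 1) : μ {x | √(2 * v * Real.log (1 / δ)) < X x} ≤ ENNReal.ofReal δ := by
  have hlog : 0 ≤ Real.log (1 / δ) := Real.log_nonneg (one_le_one_div hδ hδ1)
  rcases eq_zero_or_pos v with rfl | hv
  · refine (measure_mono_null (fun x (hx : _ < X x) => ?_)
      hX.ae_eq_zero_of_hasSubgaussianMGF_zero).trans_le zero_le
    exact ((Real.sqrt_nonneg _).trans_lt hx).ne'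
  · have hexp : Real.exp (-√(2 * v * Real.log (1 / δ)) ^ 2 / (2 * v)) = δ := by
      rw [Real.sq_sqrt (by positivity), neg_div, mul_div_cancel_left₀ _ (by positivity), one_div,
        Real.log_inv, neg_neg, Real.exp_log hδ]
    refine (measure_mono fun x (hx : _ < X x) => hx.le).trans
      ((ENNReal.le_ofReal_iff_toReal_le (measure_ne_top _ _) hδ.le).2 ?_)
    exact (hX.measure_ge_le (Real.sqrt_nonneg _)).trans_eq hexp

lemma HasBoundedDifferences.measure_integral_add_lt_le {n : ℕ} {E : Fin n → Type*}
    [∀ i, MeasurableSpace (E i)] (μ : ∀ i, Measure (E i)) [∀ i, IsProbabilityMeasure (μ i)]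
    {f : (∀ i, E i) → ℝ} {c : Fin n → ℝ≥0} (hf : HasBoundedDifferences f c) (hfm : Measurable f)
    {δ : ℝ} (hδ : 0 < δ) (hδ1 : δ ≤ 1) :
    Measure.pi μ {y | (∫ y, f y ∂Measure.pi μ) + √((∑ i, (c i : ℝ) ^ 2) * Real.log (1 / δ) / 2)
      < f y} ≤ ENNReal.ofReal δ := by
  have hvar : 2 * ((∑ i, (c i / 2) ^ 2 : ℝ≥0) : ℝ) = (∑ i, (c i : ℝ) ^ 2) / 2 := by
    push_cast
    simp only [div_pow, ← Finset.sum_div]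
    ring
  refine le_of_eq_of_le ?_
    (measure_sqrt_lt_le_of_hasSubgaussianMGF (hf.hasSubgaussianMGF μ hfm) hδ hδ1)
  congr 1 with y
  rw [Set.mem_ofPred_eq, Set.mem_ofPred_eq, lt_sub_iff_add_lt', hvar, div_mul_eq_mul_div]

end BoundedDifferences

section BoundedFamilies

lemma measurable_iSup_of_continuous {ι Ω : Type*} [TopologicalSpace ι] [SecondCountableTopology ι]
    [MeasurableSpace Ω] {F : ι → Ω → ℝ} (hm : ∀ i, Measurable (F i))
    (hc : ∀ x, Continuous fun i => F i x) : Measurable fun x => ⨆ i, F i x := by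
  obtain ⟨s, hs, hd⟩ := TopologicalSpace.exists_countable_dense ι
  have := hs.to_subtype
  have h : (fun x => ⨆ i, F i x) = fun x => ⨆ i : s, F i x :=
    funext fun x => (hd.ciSup' (hc x)).symm
  exact h ▸ Measurable.iSup fun i => hm i

lemma abs_average_le {n : ℕ} {a : Fin n → ℝ} {C : ℝ≥0} (h : ∀ j, |a j| ≤ C) :
    |(1 / (n : ℝ)) * ∑ j, a j| ≤ C := by
  rcases n.eq_zero_or_pos with rfl | hn
  · simp
  rw [abs_mul, abs_of_nonneg (by positivity)]
  calc 1 / (n : ℝ) * |∑ j, a j| ≤ 1 / n * ∑ _j : Fin n, (C : ℝ) := by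
        gcongr
        exact (Finset.abs_sum_le_sum_abs _ _).trans (Finset.sum_le_sum fun j _ => h j)
    _ = C := by simp [hn.ne']

lemma iSup_abs_le_iSup_abs_add {ι : Type*} {a b : ι → ℝ} {C c : ℝ} (hc : 0 ≤ c)
    (hb : ∀ i, |b i| ≤ C) (h : ∀ i, |a i - b i| ≤ c) : ⨆ i, |a i| ≤ (⨆ i, |b i|) + c := by
  refine Real.iSup_le (fun i => ?_) (add_nonneg (Real.iSup_nonneg fun i => abs_nonneg _) hc)
  have hle : |b i| ≤ ⨆ i, |b i| :=
    le_ciSup (f := fun i => |b i|) ⟨C, Set.forall_mem_range.2 hb⟩ i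
  linarith [h i, abs_sub_abs_le_abs_sub (a i) (b i)]

lemma abs_iSup_abs_le {ι : Type*} {a : ι → ℝ} {C : ℝ≥0} (h : ∀ i, |a i| ≤ C) :
    |(⨆ i, |a i|)| ≤ C := by
  rw [abs_of_nonneg (Real.iSup_nonneg fun i => abs_nonneg _)]
  exact Real.iSup_le h C.coe_nonneg

lemma sum_comp_sub_sum_comp_update {E : Type*} {n : ℕ} (f : E → ℝ) (y : Fin n → E) (k : Fin n)
    (e : E) : ∑ j, f (y j) - ∑ j, f (Function.update y k e j) = f (y k) - f e := by
  rw [← Finset.sum_sub_distrib, Finset.sum_eq_single_of_mem k (Finset.mem_univ k)]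
  · rw [Function.update_self]
  · intro j _ hj
    rw [Function.update_of_ne hj, sub_self]

/-- A family of measurable functions which are bounded by `C` and depend continuously on the
parameter. For a second countable parameter space the continuity makes the suprema over the
parameter measurable. -/
structure IsBoundedFamily {ι E : Type*} [TopologicalSpace ι] [MeasurableSpace E]
    (g : ι → E → ℝ) (C : ℝ≥0) : Prop where
  measurable : ∀ i, Measurable (g i)
  continuous : ∀ e, Continuous fun i => g i e
  bound : ∀ i e, |g i e| ≤ C

namespace IsBoundedFamily

variable {ι E : Type*} [TopologicalSpace ι] [MeasurableSpace E] {P : Measure E}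
  {g : ι → E → ℝ} {C : ℝ≥0} {n : ℕ}

lemma integrable (h : IsBoundedFamily g C) [IsFiniteMeasure P] (i : ι) : Integrable (g i) P :=
  .of_bound (h.measurable i).aestronglyMeasurable C (ae_of_all _ (h.bound i))

lemma abs_integral_le (h : IsBoundedFamily g C) [IsProbabilityMeasure P] (i : ι) :
    |∫ e, g i e ∂P| ≤ C := by
  simpa using norm_integral_le_of_norm_le_const (μ := P) (f := g i) (ae_of_all _ (h.bound i))

lemma continuous_integral (h : IsBoundedFamily g C) [IsFiniteMeasure P]
    [FirstCountableTopology ι] : Continuous fun i => ∫ e, g i e ∂P :=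
  continuous_of_dominated (fun i => (h.measurable i).aestronglyMeasurable)
    (fun i => ae_of_all _ (h.bound i)) (integrable_const (C : ℝ)) (ae_of_all _ h.continuous)

lemma measurable_uniformDev (h : IsBoundedFamily g C) [IsFiniteMeasure P]
    [SecondCountableTopology ι] : Measurable (uniformDev P g (n := n)) := by
  refine measurable_iSup_of_continuous (fun i => ?_) fun y => ?_
  · have := h.measurable i
    fun_prop
  · have := h.continuous
    have := h.continuous_integral (P := P)
    fun_prop

lemma hasBoundedDifferences_uniformDev (h : IsBoundedFamily g C) [IsProbabilityMeasure P] :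
    HasBoundedDifferences (uniformDev P g (n := n)) fun _ => 2 * C / n := by
  intro y k e
  have hdev (y : Fin n → E) (i : ι) :
      |(∫ e, g i e ∂P) - 1 / (n : ℝ) * ∑ j, g i (y j)| ≤ C + C :=
    (abs_sub _ _).trans (add_le_add (h.abs_integral_le i) (abs_average_le fun j => h.bound i _))
  have hupdate (i : ι) : |((∫ e, g i e ∂P) - 1 / (n : ℝ) * ∑ j, g i (Function.update y k e j))
      - ((∫ e, g i e ∂P) - 1 / (n : ℝ) * ∑ j, g i (y j))| ≤ 2 * C / n := by
    rw [sub_sub_sub_cancel_left, ← mul_sub, sum_comp_sub_sum_comp_update, abs_mul,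
      abs_of_nonneg (by positivity), one_div, inv_mul_eq_div]
    gcongr
    linarith [abs_sub (g i (y k)) (g i e), h.bound i (y k), h.bound i e]
  have hn : (0 : ℝ) ≤ 2 * C / n := by positivity
  rw [abs_le, NNReal.coe_div, NNReal.coe_mul, NNReal.coe_ofNat, NNReal.coe_natCast]
  constructor
  · linarith [show uniformDev P g y ≤ uniformDev P g (Function.update y k e) + 2 * C / n from
      iSup_abs_le_iSup_abs_add hn (hdev _) fun i => (abs_sub_comm _ _).trans_le (hupdate i)]
  · linarith [show uniformDev P g (Function.update y k e) ≤ uniformDev P g y + 2 * C / n from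
      iSup_abs_le_iSup_abs_add hn (hdev _) hupdate]

lemma measure_lt_uniformDev_le (h : IsBoundedFamily g C) [IsProbabilityMeasure P]
    [SecondCountableTopology ι] {δ r : ℝ} (hδ : 0 < δ) (hδ1 : δ ≤ 1)
    (hr : ∫ y, uniformDev P g y ∂(Measure.pi fun _ : Fin n => P) ≤ r) :
    (Measure.pi fun _ : Fin n => P) {y | r + 2 * C * √(Real.log (1 / δ) / (2 * n))
      < uniformDev P g y} ≤ ENNReal.ofReal δ := by
  have hdev := (h.hasBoundedDifferences_uniformDev (P := P) (n := n)).measure_integral_add_lt_le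
    (fun _ => P) h.measurable_uniformDev hδ hδ1
  have hsqrt : √((∑ _i : Fin n, ((2 * C / n : ℝ≥0) : ℝ) ^ 2) * Real.log (1 / δ) / 2)
      = 2 * C * √(Real.log (1 / δ) / (2 * n)) := by
    rw [← Real.sqrt_sq (by positivity : (0 : ℝ) ≤ 2 * C), ← Real.sqrt_mul (by positivity)]
    rcases n.eq_zero_or_pos with rfl | hn
    · simp
    · congr 1
      simp only [Finset.sum_const, Finset.card_univ, Fintype.card_fin, nsmul_eq_mul]
      push_cast
      field_simp
  rw [hsqrt] at hdev
  exact (measure_mono fun y (hy : _ < _) => (by gcongr : _ ≤ r + _).trans_lt hy).trans hdev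

lemma abs_signMean_le (h : IsBoundedFamily g C) (ε : Fin n → ℤˣ) (y : Fin n → E) (i : ι) :
    |(1 / (n : ℝ)) * signSum ε fun j => g i (y j)| ≤ C :=
  abs_average_le fun j => by
    rw [smul_eq_mul, abs_mul, ← Int.cast_abs, Int.isUnit_iff_abs_eq.1 (ε j).isUnit, Int.cast_one,
      one_mul]
    exact h.bound i _

lemma abs_signMean_le_signDev (h : IsBoundedFamily g C) (ε : Fin n → ℤˣ) (y : Fin n → E) (i : ι) :
    |(1 / (n : ℝ)) * signSum ε fun j => g i (y j)| ≤ signDev g ε y :=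
  le_ciSup (f := fun i => |(1 / (n : ℝ)) * signSum ε fun j => g i (y j)|)
    ⟨C, Set.forall_mem_range.2 (h.abs_signMean_le ε y)⟩ i

lemma measurable_signDev (h : IsBoundedFamily g C) [SecondCountableTopology ι]
    (ε : Fin n → ℤˣ) : Measurable (signDev g ε) := by
  refine measurable_iSup_of_continuous (fun i => ?_) fun y => ?_
  · have := h.measurable i
    simp only [signSum]
    fun_prop
  · have := h.continuous
    simp only [signSum]
    fun_prop

lemma integrable_signDev_comp (h : IsBoundedFamily g C) [SecondCountableTopology ι]
    (ε : Fin n → ℤˣ) {Ω : Type*} [MeasurableSpace Ω] (μ : Measure Ω) [IsFiniteMeasure μ]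
    {u : Ω → Fin n → E} (hu : Measurable u) : Integrable (fun x => signDev g ε (u x)) μ :=
  .of_bound ((h.measurable_signDev ε).comp hu).aestronglyMeasurable C
    (ae_of_all _ fun x => abs_iSup_abs_le (h.abs_signMean_le ε (u x)))

section Symmetrization

lemma sub_comp (h : IsBoundedFamily g C) :
    IsBoundedFamily (fun i (e : E × E) => g i e.2 - g i e.1) (C + C) where
  measurable i := ((h.measurable i).comp measurable_snd).sub ((h.measurable i).comp measurable_fst)
  continuous e := (h.continuous e.2).sub (h.continuous e.1)
  bound i _ := (abs_sub _ _).trans (add_le_add (h.bound i _) (h.bound i _))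

lemma integral_sub_average_eq (h : IsBoundedFamily g C) [IsProbabilityMeasure P] (hn : 0 < n)
    (y : Fin n → E) (i : ι) :
    (∫ e, g i e ∂P) - 1 / (n : ℝ) * ∑ j, g i (y j)
      = ∫ y', 1 / (n : ℝ) * ∑ j, (g i (y' j) - g i (y j)) ∂(Measure.pi fun _ : Fin n => P) := by
  have hn' : (n : ℝ) ≠ 0 := (Nat.cast_pos.2 hn).ne'
  have hmp (j : Fin n) := measurePreserving_eval (fun _ : Fin n => P) j
  have hint (j : Fin n) : Integrable (fun y' : Fin n → E => g i (y' j))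
      (Measure.pi fun _ : Fin n => P) :=
    (hmp j).integrable_comp_of_integrable (h.integrable i)
  have heval (j : Fin n) :
      ∫ y', g i (y' j) ∂(Measure.pi fun _ : Fin n => P) = ∫ e, g i e ∂P := by
    conv_rhs => rw [← (hmp j).map_eq]
    exact (integral_map (hmp j).measurable.aemeasurable (h.measurable i).aestronglyMeasurable).symm
  have hint' (j : Fin n) : Integrable (fun y' : Fin n → E => g i (y' j) - g i (y j))
      (Measure.pi fun _ : Fin n => P) :=
    (hint j).sub (integrable_const _)
  rw [integral_const_mul, integral_finsetSum _ fun j _ => hint' j]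
  simp only [integral_sub (hint _) (integrable_const _), heval, integral_const, probReal_univ,
    one_smul, Finset.sum_sub_distrib, Finset.sum_const, Finset.card_univ, Fintype.card_fin,
    nsmul_eq_mul, mul_sub]
  field_simp

variable [SecondCountableTopology ι] [IsProbabilityMeasure P]

lemma uniformDev_le_integral_signDev (h : IsBoundedFamily g C) (hn : 0 < n) (y : Fin n → E) :
    uniformDev P g y ≤ ∫ y', signDev (fun i (e : E × E) => g i e.2 - g i e.1) 1
      (fun j => (y j, y' j)) ∂(Measure.pi fun _ : Fin n => P) := by
  refine Real.iSup_le (fun i => ?_)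
    (integral_nonneg fun y' => Real.iSup_nonneg fun i => abs_nonneg _)
  rw [h.integral_sub_average_eq hn]
  refine abs_integral_le_integral_abs.trans (integral_mono_of_nonneg
    (ae_of_all _ fun _ => abs_nonneg _) (h.sub_comp.integrable_signDev_comp 1 _ (by fun_prop))
    (ae_of_all _ fun y' => ?_))
  simpa [signSum] using h.sub_comp.abs_signMean_le_signDev 1 (fun j => (y j, y' j)) i

lemma integral_uniformDev_le_integral_signDev (h : IsBoundedFamily g C) (hn : 0 < n) :
    ∫ y, uniformDev P g y ∂(Measure.pi fun _ : Fin n => P)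
      ≤ ∫ q, signDev (fun i (e : E × E) => g i e.2 - g i e.1) 1 q
        ∂(Measure.pi fun _ : Fin n => P.prod P) := by
  have hzip := (measurePreserving_arrowProdEquivProdArrow E E (Fin n) (fun _ => P) fun _ => P).symm
  rw [← hzip.integral_comp', integral_prod]
  · refine integral_mono (h.hasBoundedDifferences_uniformDev.integrable h.measurable_uniformDev _)
      ?_ (h.uniformDev_le_integral_signDev hn)
    exact (h.sub_comp.integrable_signDev_comp 1 _ hzip.measurable).integral_prod_left
  · exact h.sub_comp.integrable_signDev_comp 1 _ hzip.measurable

/-- The law of the pairs `(y j, y' j)` is invariant under exchanging the two entries of those with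
`ε j = -1`, and this exchange multiplies `g i (y' j) - g i (y j)` by `ε j`. -/
lemma integral_signDev_one_eq (h : IsBoundedFamily g C) (ε : Fin n → ℤˣ) :
    ∫ q, signDev (fun i (e : E × E) => g i e.2 - g i e.1) 1 q
        ∂(Measure.pi fun _ : Fin n => P.prod P)
      = ∫ q, signDev (fun i (e : E × E) => g i e.2 - g i e.1) ε q
        ∂(Measure.pi fun _ : Fin n => P.prod P) := by
  have hswap : MeasurePreserving
      (fun (q : Fin n → E × E) j => (if ε j = 1 then id else Prod.swap) (q j))
      (Measure.pi fun _ => P.prod P) (Measure.pi fun _ => P.prod P) :=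
    measurePreserving_pi _ _ fun j => by
      split_ifs
      · exact MeasurePreserving.id _
      · exact Measure.measurePreserving_swap
  conv_lhs => rw [← hswap.map_eq]
  rw [integral_map hswap.measurable.aemeasurable
    (h.sub_comp.measurable_signDev 1).aestronglyMeasurable]
  refine integral_congr_ae (ae_of_all _ fun q => ?_)
  simp only [signDev, signSum]
  congr! 5 with i j
  rcases Int.units_eq_one_or (ε j) with hj | hj <;> simp [hj]

lemma integral_signDev_sub_le (h : IsBoundedFamily g C) (ε : Fin n → ℤˣ) :
    ∫ q, signDev (fun i (e : E × E) => g i e.2 - g i e.1) ε q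
        ∂(Measure.pi fun _ : Fin n => P.prod P)
      ≤ 2 * ∫ y, signDev g ε y ∂(Measure.pi fun _ : Fin n => P) := by
  have hle (q : Fin n → E × E) : signDev (fun i (e : E × E) => g i e.2 - g i e.1) ε q
      ≤ signDev g ε (fun j => (q j).1) + signDev g ε fun j => (q j).2 := by
    refine Real.iSup_le (fun i => ?_) (add_nonneg (Real.iSup_nonneg fun i => abs_nonneg _)
      (Real.iSup_nonneg fun i => abs_nonneg _))
    simp only [signSum, smul_sub, Finset.sum_sub_distrib, mul_sub]
    rw [abs_sub_comm]
    exact (abs_sub _ _).trans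
      (add_le_add (h.abs_signMean_le_signDev _ _ i) (h.abs_signMean_le_signDev _ _ i))
  have hfst : MeasurePreserving (fun (q : Fin n → E × E) j => (q j).1)
      (Measure.pi fun _ => P.prod P) (Measure.pi fun _ => P) :=
    measurePreserving_pi _ _ fun _ => measurePreserving_fst
  have hsnd : MeasurePreserving (fun (q : Fin n → E × E) j => (q j).2)
      (Measure.pi fun _ => P.prod P) (Measure.pi fun _ => P) :=
    measurePreserving_pi _ _ fun _ => measurePreserving_snd
  have hmarg {u : (Fin n → E × E) → Fin n → E} (hu : MeasurePreserving u
      (Measure.pi fun _ => P.prod P) (Measure.pi fun _ => P)) :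
      ∫ q, signDev g ε (u q) ∂(Measure.pi fun _ : Fin n => P.prod P)
        = ∫ y, signDev g ε y ∂(Measure.pi fun _ : Fin n => P) := by
    conv_rhs => rw [← hu.map_eq]
    exact (integral_map hu.measurable.aemeasurable
      (h.measurable_signDev ε).aestronglyMeasurable).symm
  have hint1 := h.integrable_signDev_comp ε (Measure.pi fun _ => P.prod P) hfst.measurable
  have hint2 := h.integrable_signDev_comp ε (Measure.pi fun _ => P.prod P) hsnd.measurable
  refine (integral_mono (h.sub_comp.integrable_signDev_comp ε _ measurable_id)
    (hint1.add hint2) hle).trans_eq ?_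
  rw [integral_add' hint1 hint2, hmarg hfst, hmarg hsnd, two_mul]

lemma rademacher_eq_average (h : IsBoundedFamily g C) :
    rademacher P g n = (1 / (2 : ℝ) ^ n)
      * ∑ ε, ∫ y, signDev g ε y ∂(Measure.pi fun _ : Fin n => P) := by
  have hint (ε : Fin n → ℤˣ) : Integrable (signDev g ε) (Measure.pi fun _ : Fin n => P) :=
    h.integrable_signDev_comp ε _ measurable_id
  rw [← integral_finsetSum _ fun ε _ => hint ε, ← integral_const_mul]
  rfl

lemma integral_uniformDev_le (h : IsBoundedFamily g C) (hn : 0 < n) :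
    ∫ y, uniformDev P g y ∂(Measure.pi fun _ : Fin n => P) ≤ 2 * rademacher P g n := by
  have hsign (ε : Fin n → ℤˣ) : ∫ y, uniformDev P g y ∂(Measure.pi fun _ : Fin n => P)
      ≤ 2 * ∫ y, signDev g ε y ∂(Measure.pi fun _ : Fin n => P) :=
    (h.integral_uniformDev_le_integral_signDev hn).trans
      ((h.integral_signDev_one_eq ε).trans_le (h.integral_signDev_sub_le ε))
  have hsum := Finset.sum_le_sum fun ε (_ : ε ∈ Finset.univ) => hsign ε
  rw [Finset.sum_const, Finset.card_univ, nsmul_eq_mul, ← Finset.mul_sum,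
    show (Fintype.card (Fin n → ℤˣ) : ℝ) = 2 ^ n by simp] at hsum
  rw [h.rademacher_eq_average, mul_left_comm, one_div, inv_mul_eq_div, le_div_iff₀' (by positivity)]
  exact hsum

end Symmetrization

end IsBoundedFamily

end BoundedFamilies

section ScoreFamilies

lemma IsBoundedFamily.add_const {ι E : Type*} [TopologicalSpace ι] [MeasurableSpace E]
    {g : ι → E → ℝ} {C : ℝ≥0} (h : IsBoundedFamily g C) (a : ℝ) :
    IsBoundedFamily (fun i e => g i e + a) (C + ‖a‖₊) where
  measurable i := (h.measurable i).add_const _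
  continuous e := (h.continuous e).add continuous_const
  bound i e := (abs_add_le _ _).trans (add_le_add_left (h.bound i e) _)

lemma exists_lipschitzWith_bounded_eqOn_Icc {F : ℝ → ℝ} {Λ Q : ℝ≥0}
    (hF : LipschitzOnWith Λ F (Set.Icc (-Q) Q)) :
    ∃ G : ℝ → ℝ, LipschitzWith Λ G ∧ G 0 = 0 ∧ (∀ t, |G t| ≤ (Λ * Q : ℝ≥0)) ∧
      ∀ t ∈ Set.Icc (-Q : ℝ) Q, F t = G t + F 0 := by
  have hQ : (-Q : ℝ) ≤ Q := neg_le_self Q.coe_nonneg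
  have h0 : (0 : ℝ) ∈ Set.Icc (-Q : ℝ) Q := by simp
  refine ⟨fun t => F (Set.projIcc (-Q : ℝ) Q hQ t) - F 0, ?_, ?_, fun t => ?_, fun t ht => ?_⟩
  · refine LipschitzWith.of_dist_le_mul fun s t => ?_
    rw [dist_sub_right]
    refine (hF.dist_le_mul _ (Subtype.prop _) _ (Subtype.prop _)).trans ?_
    gcongr
    exact ((LipschitzWith.projIcc hQ).dist_le_mul s t).trans_eq (one_mul _)
  · simp only [Set.projIcc_of_mem hQ h0, sub_self]
  · have hdist := hF.dist_le_mul _ (Set.projIcc (-Q : ℝ) Q hQ t).2 0 h0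
    rw [Real.dist_eq, Real.dist_eq, sub_zero] at hdist
    rw [NNReal.coe_mul]
    exact hdist.trans (by gcongr; exact abs_le.2 (Set.projIcc (-Q : ℝ) Q hQ t).2)
  · simp only [Set.projIcc_of_mem hQ ht, sub_add_cancel]

section Congr

variable {ι E : Type*} [MeasurableSpace E] {P : Measure E} [IsProbabilityMeasure P]
  {g g' : ι → E → ℝ} {n : ℕ}

lemma ae_pi_forall {p : E → Prop} (h : ∀ᵐ e ∂P, p e) :
    ∀ᵐ y ∂(Measure.pi fun _ : Fin n => P), ∀ j, p (y j) :=
  ae_all_iff.2 fun j =>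
    (Measure.tendsto_eval_ae_ae (μ := fun _ : Fin n => P) (i := j)).eventually h

lemma uniformDev_ae_congr (h : ∀ᵐ e ∂P, ∀ i, g i e = g' i e) :
    uniformDev P g =ᵐ[Measure.pi fun _ : Fin n => P] uniformDev P g' := by
  filter_upwards [ae_pi_forall h] with y hy
  refine congrArg iSup (funext fun i => ?_)
  rw [integral_congr_ae (h.mono fun e he => he i), Finset.sum_congr rfl fun j _ => hy j i]

lemma rademacher_congr (h : ∀ᵐ e ∂P, ∀ i, g i e = g' i e) :
    rademacher P g n = rademacher P g' n := by
  refine integral_congr_ae ((ae_pi_forall h).mono fun y hy => ?_)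
  simp only [fun i j => hy j i]

lemma uniformDev_add_const (hg : ∀ i, Integrable (g i) P) (hn : 0 < n) (a : ℝ) (y : Fin n → E) :
    uniformDev P (fun i e => g i e + a) y = uniformDev P g y := by
  refine congrArg iSup (funext fun i => congrArg abs ?_)
  rw [integral_add (hg i) (integrable_const a), Finset.sum_add_distrib]
  simp only [integral_const, probReal_univ, one_smul, Finset.sum_const, Finset.card_univ,
    Fintype.card_fin, nsmul_eq_mul]
  field_simp
  ring

lemma rademacher_le {r : ℝ}
    (h : ∀ᵐ y ∂(Measure.pi fun _ : Fin n => P), empRademacher g y ≤ r) :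
    rademacher P g n ≤ r := by
  have hnonneg (y : Fin n → E) : 0 ≤ empRademacher g y :=
    mul_nonneg (by positivity)
      (Finset.sum_nonneg fun ε _ => Real.iSup_nonneg fun i => abs_nonneg _)
  calc rademacher P g n ≤ ∫ _y, r ∂(Measure.pi fun _ : Fin n => P) := by
        rw [rademacher_eq_integral_empRademacher]
        exact integral_mono_of_nonneg (ae_of_all _ hnonneg) (integrable_const r) h
    _ = r := by simp

end Congr

/-- A family of measurable functions depending continuously on the parameter, `P`-almost all of
whose values lie in `[-Q, Q]`: the scores to which a loss function is applied. -/
structure IsScoreFamily {ι E : Type*} [TopologicalSpace ι] [MeasurableSpace E]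
    (f : ι → E → ℝ) (P : Measure E) (Q : ℝ≥0) : Prop where
  measurable : ∀ i, Measurable (f i)
  continuous : ∀ e, Continuous fun i => f i e
  ae_bound : ∀ᵐ e ∂P, ∀ i, |f i e| ≤ Q

namespace IsScoreFamily

variable {ι E : Type*} [TopologicalSpace ι] [MeasurableSpace E] {P : Measure E}
  {f : ι → E → ℝ} {F : ℝ → ℝ} {Q Λ : ℝ≥0} {n : ℕ}

lemma isBoundedFamily_comp (h : IsScoreFamily f P Q) (hF : Continuous F) {C : ℝ≥0}
    (hC : ∀ t, |F t| ≤ C) : IsBoundedFamily (fun i => F ∘ f i) C where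
  measurable i := hF.measurable.comp (h.measurable i)
  continuous e := hF.comp (h.continuous e)
  bound i e := hC (f i e)

variable [IsProbabilityMeasure P]

lemma abs_integral_sub_average_comp_le_uniformDev (h : IsScoreFamily f P Q) (hF : Continuous F)
    {y : Fin n → E} (hy : ∀ j i, |f i (y j)| ≤ Q) (i : ι) :
    |(∫ e, F (f i e) ∂P) - (1 / (n : ℝ)) * ∑ j, F (f i (y j))|
      ≤ uniformDev P (fun i => F ∘ f i) y := by
  obtain ⟨C, hC⟩ := (isCompact_Icc (a := (-Q : ℝ)) (b := Q)).exists_bound_of_continuousOn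
    hF.continuousOn
  have hbound {t : ℝ} (ht : |t| ≤ Q) : |F t| ≤ C.toNNReal :=
    (hC t (abs_le.1 ht)).trans (Real.le_coe_toNNReal C)
  refine le_ciSup (f := fun i => |(∫ e, F (f i e) ∂P) - (1 / (n : ℝ)) * ∑ j, F (f i (y j))|)
    ⟨C.toNNReal + C.toNNReal, Set.forall_mem_range.2 fun i => ?_⟩ i
  refine (abs_sub _ _).trans (add_le_add ?_ (abs_average_le fun j => hbound (hy j i)))
  simpa using norm_integral_le_of_norm_le_const (μ := P) (f := fun e => F (f i e))
    (h.ae_bound.mono fun e he => hbound (he i))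

/-- The loss may be replaced by its truncation outside `[-Q, Q]`, and centred at `0`. -/
lemma exists_isBoundedFamily_uniformDev_ae_eq (h : IsScoreFamily f P Q)
    (hF : LipschitzOnWith Λ F (Set.Icc (-Q) Q)) (hn : 0 < n) :
    ∃ G : ℝ → ℝ, LipschitzWith Λ G ∧ G 0 = 0 ∧ IsBoundedFamily (fun i => G ∘ f i) (Λ * Q) ∧
      (∀ᵐ e ∂P, ∀ i, F (f i e) = G (f i e) + F 0) ∧
      uniformDev P (fun i => F ∘ f i)
        =ᵐ[Measure.pi fun _ : Fin n => P] uniformDev P fun i => G ∘ f i := by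
  obtain ⟨G, hG, hG0, hGC, hFG⟩ := exists_lipschitzWith_bounded_eqOn_Icc hF
  have hbdd := h.isBoundedFamily_comp hG.continuous hGC
  have hae : ∀ᵐ e ∂P, ∀ i, F (f i e) = G (f i e) + F 0 :=
    h.ae_bound.mono fun e he i => hFG _ (abs_le.1 (he i))
  refine ⟨G, hG, hG0, hbdd, hae, (uniformDev_ae_congr hae).trans (ae_of_all _ fun y => ?_)⟩
  exact uniformDev_add_const hbdd.integrable hn (F 0) y

variable [SecondCountableTopology ι]

lemma measure_lt_uniformDev_comp_le (h : IsScoreFamily f P Q)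
    (hF : LipschitzOnWith Λ F (Set.Icc (-Q) Q)) (hn : 0 < n) {δ r : ℝ} (hδ : 0 < δ) (hδ1 : δ ≤ 1)
    (hr : ∫ y, uniformDev P (fun i => F ∘ f i) y ∂(Measure.pi fun _ : Fin n => P) ≤ r) :
    (Measure.pi fun _ : Fin n => P) {y | r + 2 * (Λ * Q) * √(Real.log (1 / δ) / (2 * n))
      < uniformDev P (fun i => F ∘ f i) y} ≤ ENNReal.ofReal δ := by
  obtain ⟨G, -, -, hG, -, hdev⟩ := h.exists_isBoundedFamily_uniformDev_ae_eq hF hn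
  refine (measure_mono_ae ?_).trans
    (hG.measure_lt_uniformDev_le hδ hδ1 ((integral_congr_ae hdev).symm.trans_le hr))
  filter_upwards [hdev] with y hy (hlt : _ < _)
  rw [hy] at hlt
  exact_mod_cast hlt

lemma integral_uniformDev_comp_le (h : IsScoreFamily f P Q)
    (hF : LipschitzOnWith Λ F (Set.Icc (-Q) Q)) (hn : 0 < n) :
    ∫ y, uniformDev P (fun i => F ∘ f i) y ∂(Measure.pi fun _ : Fin n => P)
      ≤ 2 * rademacher P (fun i => F ∘ f i) n := by
  obtain ⟨G, -, -, hGb, hae, -⟩ := h.exists_isBoundedFamily_uniformDev_ae_eq hF hn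
  calc ∫ y, uniformDev P (fun i => F ∘ f i) y ∂(Measure.pi fun _ : Fin n => P)
      = ∫ y, uniformDev P (fun i e => G (f i e) + F 0) y ∂(Measure.pi fun _ : Fin n => P) :=
        integral_congr_ae (uniformDev_ae_congr hae)
    _ ≤ 2 * rademacher P (fun i e => G (f i e) + F 0) n :=
        (hGb.add_const (F 0)).integral_uniformDev_le hn
    _ = 2 * rademacher P (fun i => F ∘ f i) n := by rw [← rademacher_congr hae]; rfl

lemma integral_uniformDev_comp_le_of_empRademacher_le (h : IsScoreFamily f P Q)
    (hF : LipschitzOnWith Λ F (Set.Icc (-Q) Q)) (hn : 0 < n) {r : ℝ}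
    (hr : ∀ G : ℝ → ℝ, LipschitzWith Λ G → G 0 = 0 →
      ∀ᵐ y ∂(Measure.pi fun _ : Fin n => P), empRademacher (fun i => G ∘ f i) y ≤ r) :
    ∫ y, uniformDev P (fun i => F ∘ f i) y ∂(Measure.pi fun _ : Fin n => P) ≤ 2 * r := by
  obtain ⟨G, hG, hG0, hGb, -, hdev⟩ := h.exists_isBoundedFamily_uniformDev_ae_eq hF hn
  rw [integral_congr_ae hdev]
  exact (hGb.integral_uniformDev_le hn).trans
    (mul_le_mul_of_nonneg_left (rademacher_le (hr G hG hG0)) two_pos.le)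

end IsScoreFamily

end ScoreFamilies

section Networks

lemma continuous_linLayer {Y : Type*} [TopologicalSpace Y] {a b : ℕ}
    {V : Y → Matrix (Fin b) (Fin a) ℝ} (hV : Continuous V) {x : Y → EuclideanSpace ℝ (Fin a)}
    (hx : Continuous x) : Continuous fun y => linLayer (V y) (x y) :=
  (PiLp.continuous_toLp 2 _).comp (hV.matrix_mulVec ((PiLp.continuous_ofLp 2 _).comp hx))

lemma continuous_entrywise {b : ℕ} {ρ : ℝ → ℝ} (hρ : Continuous ρ) :
    Continuous (entrywise ρ : EuclideanSpace ℝ (Fin b) → EuclideanSpace ℝ (Fin b)) :=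
  (PiLp.continuous_toLp 2 _).comp <| continuous_pi fun j =>
    hρ.comp ((continuous_apply j).comp (PiLp.continuous_ofLp 2 _))

lemma continuous_hidden {Y : Type*} [TopologicalSpace Y] {K : ℕ} {a : ℕ → ℕ} {ρ : Fin K → ℝ → ℝ}
    (hρ : ∀ i, Continuous (ρ i)) {W : Y → ∀ i : Fin K, Matrix (Fin (a (i + 1))) (Fin (a i)) ℝ}
    (hW : Continuous W) {x : Y → EuclideanSpace ℝ (Fin (a 0))} (hx : Continuous x) (i : ℕ)
    (hi : i ≤ K) : Continuous fun y => hidden a ρ (W y) (x y) i hi := by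
  induction i with
  | zero => exact hx
  | succ i ih =>
    exact (continuous_entrywise (hρ _)).comp <|
      continuous_linLayer ((continuous_apply (⟨i, hi⟩ : Fin K)).comp hW)
        (ih (Nat.le_of_succ_le hi))

end Networks

namespace Arch

variable {A : Arch}

/-- Parameters converge when all their weights do. -/
instance : TopologicalSpace A.DParam :=
  TopologicalSpace.induced (fun ω => (ω.W, ω.w)) inferInstance

/-- Parameters converge when all their weights do. -/
instance : TopologicalSpace A.GParam :=
  TopologicalSpace.induced (fun θ => (θ.V, θ.Vout)) inferInstance

instance {a b : ℕ} : SecondCountableTopology (Matrix (Fin a) (Fin b) ℝ) :=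
  inferInstanceAs (SecondCountableTopology (Fin a → Fin b → ℝ))

instance : SecondCountableTopology A.DParam :=
  TopologicalSpace.secondCountableTopology_induced _ _ _

instance : SecondCountableTopology A.GParam :=
  TopologicalSpace.secondCountableTopology_induced _ _ _

lemma continuous_preact {Y : Type*} [TopologicalSpace Y] {ω : Y → A.DParam} (hω : Continuous ω)
    {x : Y → A.Data} (hx : Continuous x) : Continuous fun y => preact (ω y) (x y) := by
  have hweights : Continuous fun y => ((ω y).W, (ω y).w) := continuous_induced_dom.comp hω
  exact hweights.snd.inner
    (continuous_hidden (fun i => (A.r_lipschitz i).continuous) hweights.fst hx _ _)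

lemma continuous_gen {Y : Type*} [TopologicalSpace Y] {θ : Y → A.GParam} (hθ : Continuous θ)
    {z : Y → A.Latent} (hz : Continuous z) : Continuous fun y => gen (θ y) (z y) := by
  have hweights : Continuous fun y => ((θ y).V, (θ y).Vout) := continuous_induced_dom.comp hθ
  exact continuous_linLayer hweights.snd
    (continuous_hidden (fun j => (A.s_lipschitz j).continuous) hweights.fst hz _ _)

lemma isScoreFamily_preact {P : Measure A.Data} {B : ℝ} (hB : 0 ≤ B) (hP : ∀ᵐ x ∂P, ‖x‖ ≤ B) :
    IsScoreFamily (fun ω : A.discSet => preact ω.1) P (.mk (A.Qx B) (Qx_nonneg hB)) where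
  measurable _ := (continuous_preact continuous_const continuous_id).measurable
  continuous _ := continuous_preact continuous_subtype_val continuous_const
  ae_bound := hP.mono fun _ hx ω => abs_preact_le_Qx ω.2 hx

lemma isScoreFamily_preact_gen {P : Measure A.Latent} {B : ℝ} (hB : 0 ≤ B)
    (hP : ∀ᵐ z ∂P, ‖z‖ ≤ B) :
    IsScoreFamily (fun q : A.discSet × A.genSet => preact q.1.1 ∘ gen q.2.1) P
      (.mk (A.Qz B) (Qz_nonneg hB)) where
  measurable _ := (continuous_preact continuous_const
    (continuous_gen continuous_const continuous_id)).measurable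
  continuous _ := continuous_preact (continuous_subtype_val.comp continuous_fst)
    (continuous_gen (continuous_subtype_val.comp continuous_snd) continuous_const)
  ae_bound := hP.mono fun _ hz q => abs_preact_gen_le_Qz q.1.2 q.2.2 hz

end Arch

section Sigmoid

lemma sigmoid_mem_Ioo (t : ℝ) : Real.sigmoid t ∈ Set.Ioo (0 : ℝ) 1 :=
  ⟨Real.sigmoid_pos t, Real.sigmoid_lt_one t⟩

lemma mul_one_sub_le_quarter (p : ℝ) : p * (1 - p) ≤ 1 / 4 := by
  linarith [sq_nonneg (p - 1 / 2), show p * (1 - p) = 1 / 4 - (p - 1 / 2) ^ 2 by ring]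

lemma lipschitzWith_sigmoid : LipschitzWith (1 / 4) Real.sigmoid := by
  refine lipschitzWith_of_nnnorm_deriv_le differentiable_sigmoid fun t => ?_
  rw [← NNReal.coe_le_coe, coe_nnnorm, Real.deriv_sigmoid, Real.norm_of_nonneg
    (mul_nonneg (Real.sigmoid_nonneg t) (sub_nonneg.2 (Real.sigmoid_le_one t)))]
  exact_mod_cast mul_one_sub_le_quarter (Real.sigmoid t)

lemma lipschitzWith_comp_sigmoid {φ : ℝ → ℝ} {L : ℝ≥0} (hφ : LipschitzOnWith L φ (Set.Ioo 0 1)) :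
    LipschitzWith (L * (1 / 4)) (φ ∘ Real.sigmoid) :=
  lipschitzOnWith_univ.1 (hφ.comp (lipschitzWith_sigmoid.lipschitzOnWith (s := Set.univ))
    fun t _ => sigmoid_mem_Ioo t)

lemma continuous_comp_sigmoid {φ : ℝ → ℝ} (hφ : ContinuousOn φ (Set.Ioo 0 1)) :
    Continuous (φ ∘ Real.sigmoid) :=
  hφ.comp_continuous continuous_sigmoid sigmoid_mem_Ioo

end Sigmoid

section AlphaLoss

/-- The exponent `(α - 1) / α` of the `α`-loss, with the limit `1` at `α = ∞`. -/
noncomputable def alphaExponent (α : ℝ≥0∞) : ℝ :=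
  if α = ⊤ then 1 else (α.toReal - 1) / α.toReal

lemma hasDerivAt_neg_alphaLossOne {α : ℝ≥0∞} (hα : 0 < α) {p : ℝ} (hp : 0 < p) :
    HasDerivAt (fun p => -alphaLossOne α p) (p ^ (alphaExponent α - 1)) p := by
  unfold alphaLossOne alphaExponent
  split_ifs with htop hone
  · rw [sub_self, Real.rpow_zero]
    simpa using hasDerivAt_id' p
  · subst hone
    simpa [Real.rpow_neg_one] using Real.hasDerivAt_log hp.ne'
  · have hpos : 0 < α.toReal := ENNReal.toReal_pos hα.ne' htop
    have hsub : α.toReal - 1 ≠ 0 := sub_ne_zero.2 (mt (ENNReal.toReal_eq_one_iff α).1 hone)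
    refine (((Real.hasDerivAt_rpow_const (p := (α.toReal - 1) / α.toReal)
      (Or.inl hp.ne')).const_sub 1).const_mul (α.toReal / (α.toReal - 1))).neg.congr_deriv ?_
    generalize p ^ ((α.toReal - 1) / α.toReal - 1) = u
    field_simp

lemma hasDerivAt_neg_alphaLossOne_sigmoid {α : ℝ≥0∞} (hα : 0 < α) (t : ℝ) :
    HasDerivAt (fun t => -alphaLossOne α (Real.sigmoid t))
      (Real.sigmoid t ^ alphaExponent α * (1 - Real.sigmoid t)) t := by
  refine ((hasDerivAt_neg_alphaLossOne hα (Real.sigmoid_pos t)).comp t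
    (Real.hasDerivAt_sigmoid t)).congr_deriv ?_
  rw [← mul_assoc, ← Real.rpow_add_one (Real.sigmoid_pos t).ne', sub_add_cancel]

/-- Weighted AM-GM for `p / v` and `(1 - p) / w`. -/
lemma rpow_mul_one_sub_le {v w p : ℝ} (hv : 0 < v) (hw : 0 < w) (hvw : v + w = 1)
    (hp : 0 < p) (hp1 : p < 1) : p ^ (v / w) * (1 - p) ≤ v ^ (v / w) * w := by
  have hq : 0 < 1 - p := sub_pos.2 hp1
  have hamgm : (p / v) ^ v * ((1 - p) / w) ^ w ≤ 1 := by
    have h := Real.geom_mean_le_arith_mean2_weighted hv.le hw.le (div_pos hp hv).le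
      (div_pos hq hw).le hvw
    rwa [mul_div_cancel₀ _ hv.ne', mul_div_cancel₀ _ hw.ne', add_sub_cancel] at h
  have hroot := Real.rpow_le_rpow (by positivity) hamgm (one_div_pos.2 hw).le
  rw [Real.one_rpow, Real.mul_rpow (by positivity) (by positivity), ← Real.rpow_mul (by positivity),
    ← Real.rpow_mul (by positivity), mul_one_div, mul_one_div_cancel hw.ne', Real.rpow_one,
    Real.div_rpow hp.le hv.le, div_mul_div_comm, div_le_one (by positivity)] at hroot
  exact hroot

lemma sigmoid_rpow_mul_one_sub_le_of_nonpos {β h t : ℝ} (hβ : β ≤ 0) (ht : -h ≤ t) :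
    Real.sigmoid t ^ β * (1 - Real.sigmoid t) ≤ Real.sigmoid h * Real.sigmoid (-h) ^ β := by
  rw [mul_comm, ← Real.sigmoid_neg]
  exact mul_le_mul (Real.sigmoid_le (neg_le.1 ht))
    (Real.rpow_le_rpow_of_nonpos (Real.sigmoid_pos _) (Real.sigmoid_le ht) hβ)
    (Real.rpow_nonneg (Real.sigmoid_nonneg t) β) (Real.sigmoid_nonneg h)

lemma rpow_mul_one_sub_le_of_one_lt {a p : ℝ} (ha : 1 < a) (hp : 0 < p) (hp1 : p < 1) :
    p ^ ((a - 1) / a) * (1 - p)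
      ≤ ((a - 1) / (2 * a - 1)) ^ ((a - 1) / a) * (a / (2 * a - 1)) := by
  have hden : 0 < 2 * a - 1 := by linarith
  have h := rpow_mul_one_sub_le (v := (a - 1) / (2 * a - 1)) (w := a / (2 * a - 1))
    (div_pos (by linarith) hden) (div_pos (by linarith) hden)
    (by rw [← add_div, div_eq_one_iff_eq hden.ne']; ring) hp hp1
  rwa [div_div_div_cancel_right₀ hden.ne'] at h

lemma sigmoid_rpow_mul_le_clipConst (α : ℝ≥0∞) {h t : ℝ} (ht : -h ≤ t) :
    Real.sigmoid t ^ alphaExponent α * (1 - Real.sigmoid t) ≤ clipConst α h := by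
  unfold alphaExponent clipConst
  split_ifs with htop hle
  · rw [Real.rpow_one]
    exact mul_one_sub_le_quarter _
  · have htoReal : α.toReal ≤ 1 := ENNReal.toReal_le_of_le_ofReal one_pos.le (by simpa using hle)
    exact sigmoid_rpow_mul_one_sub_le_of_nonpos
      (div_nonpos_of_nonpos_of_nonneg (sub_nonpos.2 htoReal) ENNReal.toReal_nonneg) ht
  · have htoReal : 1 < α.toReal := by
      rw [← ENNReal.toReal_one]
      exact (ENNReal.toReal_lt_toReal ENNReal.one_ne_top htop).2 (not_le.1 hle)
    exact rpow_mul_one_sub_le_of_one_lt htoReal (Real.sigmoid_pos t) (Real.sigmoid_lt_one t)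

lemma sigmoid_rpow_mul_one_sub_nonneg (β t : ℝ) :
    0 ≤ Real.sigmoid t ^ β * (1 - Real.sigmoid t) :=
  mul_nonneg (Real.rpow_nonneg (Real.sigmoid_nonneg t) β)
    (sub_nonneg.2 (Real.sigmoid_le_one t))

lemma clipConst_nonneg (α : ℝ≥0∞) (h : ℝ) : 0 ≤ clipConst α h :=
  (sigmoid_rpow_mul_one_sub_nonneg _ _).trans (sigmoid_rpow_mul_le_clipConst α le_rfl)

lemma lipschitzOnWith_neg_alphaLossOne_sigmoid {α : ℝ≥0∞} (hα : 0 < α) (h : ℝ) :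
    LipschitzOnWith (.mk (clipConst α h) (clipConst_nonneg α h))
      (fun t => -alphaLossOne α (Real.sigmoid t)) (Set.Icc (-h) h) := by
  refine (convex_Icc (-h) h).lipschitzOnWith_of_nnnorm_hasDerivWithin_le
    (fun t _ => (hasDerivAt_neg_alphaLossOne_sigmoid hα t).hasDerivWithinAt) fun t ht => ?_
  rw [← NNReal.coe_le_coe, coe_nnnorm, Real.norm_of_nonneg (sigmoid_rpow_mul_one_sub_nonneg _ t)]
  exact sigmoid_rpow_mul_le_clipConst α ht.1

lemma lipschitzOnWith_neg_alphaLoss_sigmoid {α : ℝ≥0∞} (hα : 0 < α) (h : ℝ) (y : Fin 2) :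
    LipschitzOnWith (.mk (clipConst α h) (clipConst_nonneg α h))
      ((fun p => -alphaLoss α y p) ∘ Real.sigmoid) (Set.Icc (-h) h) := by
  have hone := lipschitzOnWith_neg_alphaLossOne_sigmoid hα h
  unfold alphaLoss
  split_ifs
  · exact hone
  · have hneg : Set.MapsTo Neg.neg (Set.Icc (-h) h) (Set.Icc (-h) h) := fun t ht =>
      ⟨neg_le_neg ht.2, neg_le.1 ht.1⟩
    have hcomp := hone.comp (LipschitzWith.id.neg.lipschitzOnWith (s := Set.Icc (-h) h)) hneg
    simpa only [mul_one, Function.comp_def, Pi.neg_apply, id, Real.sigmoid_neg] using hcomp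

lemma continuousOn_alphaLoss {α : ℝ≥0∞} (hα : 0 < α) (y : Fin 2) :
    ContinuousOn (alphaLoss α y) (Set.Ioo 0 1) := by
  have hone : ContinuousOn (alphaLossOne α) (Set.Ioo 0 1) := fun p hp => by
    simpa using (hasDerivAt_neg_alphaLossOne hα hp.1).fun_neg.continuousAt.continuousWithinAt
  unfold alphaLoss
  split_ifs
  · exact hone
  · exact hone.comp (by fun_prop) fun p hp => ⟨sub_pos.2 hp.2, sub_lt_self 1 hp.1⟩

end AlphaLoss

open Arch

section EstimationError

lemma integral_empirical {E : Type*} [MeasurableSpace E] [MeasurableSingletonClass E] {n : ℕ}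
    (x : Fin n → E) (f : E → ℝ) :
    ∫ e, f e ∂(empirical x) = (1 / (n : ℝ)) * ∑ j, f (x j) := by
  rw [empirical, integral_smul_measure, integral_finsetSum_measure fun j _ =>
    integrable_dirac (by simp)]
  simp

lemma sub_ciInf_le_two_mul_of_isMinOn {T : Type*} {s : Set T} {a b : T → ℝ} {c : ℝ} {t : T}
    (ht : t ∈ s) (hmin : IsMinOn b s t) (hab : ∀ t' ∈ s, |a t' - b t'| ≤ c) :
    a t - ⨅ t' : s, a t' ≤ 2 * c := by
  have : Nonempty s := ⟨⟨t, ht⟩⟩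
  have hinf : a t - 2 * c ≤ ⨅ t' : s, a t' := le_ciInf fun ⟨t', ht'⟩ =>
    calc a t - 2 * c ≤ b t - c := by linarith [(abs_le.1 (hab t ht)).2]
      _ ≤ b t' - c := sub_le_sub_right (hmin ht') c
      _ ≤ a t' := by linarith [(abs_le.1 (hab t' ht')).1]
  linarith

lemma nonneg_of_ae_norm_le {E : Type*} [MeasurableSpace E] [NormedAddCommGroup E] {P : Measure E}
    [IsProbabilityMeasure P] {B : ℝ} (hB : ∀ᵐ x ∂P, ‖x‖ ≤ B) : 0 ≤ B :=
  let ⟨_, hx⟩ := hB.exists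
  (norm_nonneg _).trans hx

variable {A : Arch} {Pr : Measure A.Data} {PZ : Measure A.Latent} {Bx Bz : ℝ}
  {ℓG : Fin 2 → ℝ → ℝ} {ωs : A.GParam → A.DParam} {n m : ℕ}

lemma value_genLaw_eq (hℓ : ContinuousOn (ℓG 0) (Set.Ioo 0 1)) (P : Measure A.Data)
    (Q : Measure A.Latent) (ω : A.DParam) (θ : A.GParam) :
    value ℓG ω P (genLaw Q θ)
      = (∫ x, -ℓG 1 (disc ω x) ∂P) + ∫ z, -ℓG 0 (disc ω (gen θ z)) ∂Q := by
  have hloss : Continuous fun x => -ℓG 0 (disc ω x) :=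
    ((continuous_comp_sigmoid hℓ).comp (continuous_preact continuous_const continuous_id)).neg
  have hgen : Continuous (gen θ) := continuous_gen continuous_const continuous_id
  rw [value, genLaw, integral_map hgen.measurable.aemeasurable hloss.aestronglyMeasurable]

variable [IsProbabilityMeasure Pr] [IsProbabilityMeasure PZ]

lemma abs_value_sub_value_empirical_le (hBx : ∀ᵐ x ∂Pr, ‖x‖ ≤ Bx) (hBz : ∀ᵐ z ∂PZ, ‖z‖ ≤ Bz)
    (hℓ : ∀ y, ContinuousOn (ℓG y) (Set.Ioo 0 1)) {x : Fin n → A.Data} (hx : ∀ i, ‖x i‖ ≤ Bx)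
    {z : Fin m → A.Latent} (hz : ∀ j, ‖z j‖ ≤ Bz) {ω : A.DParam} (hω : ω ∈ A.discSet)
    {θ : A.GParam} (hθ : θ ∈ A.genSet) :
    |value ℓG ω Pr (genLaw PZ θ) - value ℓG ω (empirical x) (genLaw (empirical z) θ)|
      ≤ uniformDev Pr (discFamily A fun t => -ℓG 1 t) x
        + uniformDev PZ (discGenFamily A fun t => -ℓG 0 t) z := by
  have hdata := (isScoreFamily_preact (nonneg_of_ae_norm_le hBx) hBx)
    |>.abs_integral_sub_average_comp_le_uniformDev (continuous_comp_sigmoid (hℓ 1).fun_neg)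
      (fun j ω' => abs_preact_le_Qx ω'.2 (hx j)) ⟨ω, hω⟩
  have hlatent := (isScoreFamily_preact_gen (nonneg_of_ae_norm_le hBz) hBz)
    |>.abs_integral_sub_average_comp_le_uniformDev (continuous_comp_sigmoid (hℓ 0).fun_neg)
      (fun j q => abs_preact_gen_le_Qz q.1.2 q.2.2 (hz j)) (⟨ω, hω⟩, ⟨θ, hθ⟩)
  rw [value_genLaw_eq (hℓ 0), value_genLaw_eq (hℓ 0), integral_empirical, integral_empirical,
    add_sub_add_comm]
  exact (abs_add_le _ _).trans (add_le_add hdata hlatent)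

theorem estError_le_uniformDev (hBx : ∀ᵐ x ∂Pr, ‖x‖ ≤ Bx) (hBz : ∀ᵐ z ∂PZ, ‖z‖ ≤ Bz)
    (hℓ : ∀ y, ContinuousOn (ℓG y) (Set.Ioo 0 1)) (hωs : ∀ θ ∈ A.genSet, ωs θ ∈ A.discSet)
    {x : Fin n → A.Data} (hx : ∀ i, ‖x i‖ ≤ Bx) {z : Fin m → A.Latent} (hz : ∀ j, ‖z j‖ ≤ Bz)
    {θ : A.GParam} (hθ : IsTrainedGen ℓG ωs x z θ) :
    estError ℓG ωs Pr PZ θ ≤ 2 * uniformDev Pr (discFamily A fun t => -ℓG 1 t) x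
      + 2 * uniformDev PZ (discGenFamily A fun t => -ℓG 0 t) z := by
  rw [← mul_add]
  exact sub_ciInf_le_two_mul_of_isMinOn hθ.1 hθ.2 fun θ' hθ' =>
    abs_value_sub_value_empirical_le hBx hBz hℓ hx hz (hωs θ' hθ') hθ'

end EstimationError

section HighProbability

lemma integral_uniformDev_discFamily_le {A : Arch} {P : Measure A.Data} [IsProbabilityMeasure P]
    {B : ℝ} (hB : ∀ᵐ x ∂P, ‖x‖ ≤ B) {φ : ℝ → ℝ} {Λ : ℝ≥0}
    (hφ : LipschitzOnWith Λ (φ ∘ Real.sigmoid) (Set.Icc (-A.Qx B) (A.Qx B))) {n : ℕ}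
    (hn : 0 < n) :
    ∫ y, uniformDev P (discFamily A φ) y ∂(Measure.pi fun _ : Fin n => P)
      ≤ 2 * (Λ * A.Qx B * √(3 * ((A.K : ℝ) + 1)) / √n) := by
  have hB0 := nonneg_of_ae_norm_le hB
  exact (isScoreFamily_preact hB0 hB).integral_uniformDev_comp_le_of_empRademacher_le hφ hn
    fun G hG hG0 => (ae_pi_forall hB).mono fun y hy => empRademacher_comp_preact_le hG hG0 hB0 hy

lemma integral_uniformDev_discGenFamily_le {A : Arch} {P : Measure A.Latent}
    [IsProbabilityMeasure P] {B : ℝ} (hB : ∀ᵐ z ∂P, ‖z‖ ≤ B) {ψ : ℝ → ℝ} {Λ : ℝ≥0}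
    (hψ : LipschitzOnWith Λ (ψ ∘ Real.sigmoid) (Set.Icc (-A.Qz B) (A.Qz B))) {n : ℕ}
    (hn : 0 < n) :
    ∫ y, uniformDev P (discGenFamily A ψ) y ∂(Measure.pi fun _ : Fin n => P)
      ≤ 2 * (Λ * A.Qz B * √(3 * ((A.K : ℝ) + 1 + (A.L + 1) - 1)) / √n) := by
  have hB0 := nonneg_of_ae_norm_le hB
  exact (isScoreFamily_preact_gen hB0 hB).integral_uniformDev_comp_le_of_empRademacher_le hψ hn
    fun G hG hG0 =>
      (ae_pi_forall hB).mono fun y hy => empRademacher_comp_preact_gen_le hG hG0 hB0 hy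

lemma two_mul_deviation_eq (a : ℝ) {L : ℝ} (hL : 0 ≤ L) (n : ℕ) :
    2 * (2 * a * √(L / (2 * n))) = 2 * √(2 * L) * (a / √n) := by
  rw [show L / (2 * (n : ℝ)) = 2 * L / (2 ^ 2 * n) by
    rw [show (2 : ℝ) ^ 2 * n = 2 * (2 * n) by ring, mul_div_mul_left _ _ two_ne_zero],
    Real.sqrt_div (mul_nonneg two_pos.le hL), Real.sqrt_mul (sq_nonneg (2 : ℝ)),
    Real.sqrt_sq two_pos.le]
  ring

variable {A : Arch} {Pr : Measure A.Data} [IsProbabilityMeasure Pr] {PZ : Measure A.Latent}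
  [IsProbabilityMeasure PZ] {Bx Bz : ℝ} {ℓG : Fin 2 → ℝ → ℝ} {ωs : A.GParam → A.DParam}
  {n m : ℕ} {S : Type*} [MeasurableSpace S] {μ : Measure S} {X : Fin n → S → A.Data}
  {Z : Fin m → S → A.Latent} {δ a b : ℝ} {Λ Λ' : ℝ≥0}

lemma errorBoundWithFailure_of_measure_lt_uniformDev_le
    (hBx : ∀ᵐ x ∂Pr, ‖x‖ ≤ Bx) (hBz : ∀ᵐ z ∂PZ, ‖z‖ ≤ Bz)
    (hX : HasLaw (fun t i => X i t) (Measure.pi fun _ => Pr) μ)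
    (hZ : HasLaw (fun t j => Z j t) (Measure.pi fun _ => PZ) μ)
    (hℓ : ∀ y, ContinuousOn (ℓG y) (Set.Ioo 0 1)) (hωs : ∀ θ ∈ A.genSet, ωs θ ∈ A.discSet)
    (hδ : 0 ≤ δ)
    (ha : (Measure.pi fun _ : Fin n => Pr)
      {y | a < uniformDev Pr (discFamily A fun t => -ℓG 1 t) y} ≤ ENNReal.ofReal δ)
    (hb : (Measure.pi fun _ : Fin m => PZ)
      {y | b < uniformDev PZ (discGenFamily A fun t => -ℓG 0 t) y} ≤ ENNReal.ofReal δ) :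
    ErrorBoundWithFailure μ ℓG ωs Pr PZ X Z (2 * δ) (2 * a + 2 * b) := by
  have hXnorm : ∀ᵐ t ∂μ, ∀ i, ‖X i t‖ ≤ Bx :=
    ae_of_ae_map hX.aemeasurable (hX.map_eq ▸ ae_pi_forall hBx)
  have hZnorm : ∀ᵐ t ∂μ, ∀ j, ‖Z j t‖ ≤ Bz :=
    ae_of_ae_map hZ.aemeasurable (hZ.map_eq ▸ ae_pi_forall hBz)
  have hXtail := (Measure.le_map_apply hX.aemeasurable _).trans (hX.map_eq ▸ ha)
  have hZtail := (Measure.le_map_apply hZ.aemeasurable _).trans (hZ.map_eq ▸ hb)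
  rw [ErrorBoundWithFailure, two_mul δ, ENNReal.ofReal_add hδ hδ]
  refine (measure_mono_ae ?_).trans ((measure_union_le _ _).trans (add_le_add hXtail hZtail))
  filter_upwards [hXnorm, hZnorm] with t hXt hZt ⟨θ, hθ, hlt⟩
  have hsum := hlt.trans_le (estError_le_uniformDev hBx hBz hℓ hωs hXt hZt hθ)
  rw [← mul_add, ← mul_add, mul_lt_mul_iff_right₀ two_pos] at hsum
  exact lt_or_lt_of_add_lt_add hsum

lemma errorBoundWithFailure_of_integral_uniformDev_le
    (hBx : ∀ᵐ x ∂Pr, ‖x‖ ≤ Bx) (hBz : ∀ᵐ z ∂PZ, ‖z‖ ≤ Bz)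
    (hX : HasLaw (fun t i => X i t) (Measure.pi fun _ => Pr) μ)
    (hZ : HasLaw (fun t j => Z j t) (Measure.pi fun _ => PZ) μ)
    (hℓ : ∀ y, ContinuousOn (ℓG y) (Set.Ioo 0 1)) (hωs : ∀ θ ∈ A.genSet, ωs θ ∈ A.discSet)
    (hn : 0 < n) (hm : 0 < m) (hδ : 0 < δ) (hδ1 : δ ≤ 1)
    (hφ : LipschitzOnWith Λ ((fun t => -ℓG 1 t) ∘ Real.sigmoid) (Set.Icc (-A.Qx Bx) (A.Qx Bx)))
    (hψ : LipschitzOnWith Λ' ((fun t => -ℓG 0 t) ∘ Real.sigmoid) (Set.Icc (-A.Qz Bz) (A.Qz Bz)))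
    (ha : ∫ y, uniformDev Pr (discFamily A fun t => -ℓG 1 t) y ∂(Measure.pi fun _ : Fin n => Pr)
      ≤ 2 * a)
    (hb : ∫ y, uniformDev PZ (discGenFamily A fun t => -ℓG 0 t) y
      ∂(Measure.pi fun _ : Fin m => PZ) ≤ 2 * b) :
    ErrorBoundWithFailure μ ℓG ωs Pr PZ X Z (2 * δ)
      (4 * a + 4 * b + 2 * √(2 * Real.log (1 / δ)) * (Λ * A.Qx Bx / √n + Λ' * A.Qz Bz / √m)) := by
  have hlog : 0 ≤ Real.log (1 / δ) := Real.log_nonneg (by rwa [le_div_iff₀ hδ, one_mul])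
  have htails := errorBoundWithFailure_of_measure_lt_uniformDev_le hBx hBz hX hZ hℓ hωs hδ.le
    ((isScoreFamily_preact (nonneg_of_ae_norm_le hBx) hBx).measure_lt_uniformDev_comp_le
      hφ hn hδ hδ1 ha)
    ((isScoreFamily_preact_gen (nonneg_of_ae_norm_le hBz) hBz).measure_lt_uniformDev_comp_le
      hψ hm hδ hδ1 hb)
  rw [NNReal.coe_mk, NNReal.coe_mk, mul_add 2 (2 * a), mul_add 2 (2 * b),
    two_mul_deviation_eq _ hlog, two_mul_deviation_eq _ hlog] at htails
  convert htails using 1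
  ring

theorem errorBoundWithFailure_of_lipschitzOnWith_comp_sigmoid
    (hBx : ∀ᵐ x ∂Pr, ‖x‖ ≤ Bx) (hBz : ∀ᵐ z ∂PZ, ‖z‖ ≤ Bz)
    (hX : HasLaw (fun t i => X i t) (Measure.pi fun _ => Pr) μ)
    (hZ : HasLaw (fun t j => Z j t) (Measure.pi fun _ => PZ) μ)
    (hℓ : ∀ y, ContinuousOn (ℓG y) (Set.Ioo 0 1)) (hωs : ∀ θ ∈ A.genSet, ωs θ ∈ A.discSet)
    (hn : 0 < n) (hm : 0 < m) (hδ : 0 < δ) (hδ1 : δ ≤ 1)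
    (hφ : LipschitzOnWith Λ ((fun t => -ℓG 1 t) ∘ Real.sigmoid) (Set.Icc (-A.Qx Bx) (A.Qx Bx)))
    (hψ : LipschitzOnWith Λ' ((fun t => -ℓG 0 t) ∘ Real.sigmoid)
      (Set.Icc (-A.Qz Bz) (A.Qz Bz))) :
    ErrorBoundWithFailure μ ℓG ωs Pr PZ X Z (2 * δ)
      (4 * (Λ * A.Qx Bx * √(3 * ((A.K : ℝ) + 1)) / √n)
        + 4 * (Λ' * A.Qz Bz * √(3 * ((A.K : ℝ) + 1 + (A.L + 1) - 1)) / √m)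
        + 2 * √(2 * Real.log (1 / δ)) * (Λ * A.Qx Bx / √n + Λ' * A.Qz Bz / √m)) :=
  errorBoundWithFailure_of_integral_uniformDev_le hBx hBz hX hZ hℓ hωs hn hm hδ hδ1 hφ hψ
    (integral_uniformDev_discFamily_le hBx hφ hn) (integral_uniformDev_discGenFamily_le hBz hψ hm)

lemma two_mul_sqrt_mul_quarter_eq (a L : ℝ) (n : ℕ) :
    2 * √(2 * L) * (a * (1 / 4) / √n) = √L * (a / √(2 * n)) := by
  have hsqrt : 2 / 4 * √(2 : ℝ) = 1 / √2 := by
    rw [eq_div_iff (by positivity), mul_assoc, Real.mul_self_sqrt two_pos.le]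
    norm_num
  calc 2 * √(2 * L) * (a * (1 / 4) / √n) = 2 / 4 * √2 * (√L * (a / √n)) := by
        rw [Real.sqrt_mul two_pos.le]
        ring
    _ = √L * (a / √(2 * n)) := by
        rw [hsqrt, Real.sqrt_mul two_pos.le, div_mul_eq_div_div_swap]
        ring

lemma quarter_deviation_eq (c d L : ℝ) (Λ Λ' : ℝ≥0) (n m : ℕ) :
    2 * √(2 * L) * ((Λ * (1 / 4) : ℝ≥0) * c / √n + (Λ' * (1 / 4) : ℝ≥0) * d / √m)
      = √L * (Λ * c / √(2 * n) + Λ' * d / √(2 * m)) := by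
  rw [mul_add, mul_add, ← two_mul_sqrt_mul_quarter_eq, ← two_mul_sqrt_mul_quarter_eq]
  push_cast
  ring

lemma continuousOn_of_lipschitzOnWith_neg {Lφ Lψ : ℝ≥0}
    (hφ : LipschitzOnWith Lφ (fun t => -ℓG 1 t) (Set.Ioo 0 1))
    (hψ : LipschitzOnWith Lψ (fun t => -ℓG 0 t) (Set.Ioo 0 1)) :
    ∀ y, ContinuousOn (ℓG y) (Set.Ioo 0 1) :=
  Fin.forall_fin_two.2 ⟨hψ.continuousOn.fun_neg.congr fun _ _ => (neg_neg _).symm,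
    hφ.continuousOn.fun_neg.congr fun _ _ => (neg_neg _).symm⟩

theorem errorBoundWithFailure_rademacher_of_lipschitzOnWith
    (hBx : ∀ᵐ x ∂Pr, ‖x‖ ≤ Bx) (hBz : ∀ᵐ z ∂PZ, ‖z‖ ≤ Bz)
    (hX : HasLaw (fun t i => X i t) (Measure.pi fun _ => Pr) μ)
    (hZ : HasLaw (fun t j => Z j t) (Measure.pi fun _ => PZ) μ)
    (hωs : ∀ θ ∈ A.genSet, ωs θ ∈ A.discSet) (hn : 0 < n) (hm : 0 < m)
    (hδ : 0 < δ) (hδ1 : δ ≤ 1) {Lφ Lψ : ℝ≥0}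
    (hφ : LipschitzOnWith Lφ (fun t => -ℓG 1 t) (Set.Ioo 0 1))
    (hψ : LipschitzOnWith Lψ (fun t => -ℓG 0 t) (Set.Ioo 0 1)) :
    ErrorBoundWithFailure μ ℓG ωs Pr PZ X Z (2 * δ)
      (4 * rademacher Pr (discFamily A fun t => -ℓG 1 t) n
        + 4 * rademacher PZ (discGenFamily A fun t => -ℓG 0 t) m
        + √(Real.log (1 / δ)) * (Lφ * A.Qx Bx / √(2 * n) + Lψ * A.Qz Bz / √(2 * m))) := by
  have hφσ := (lipschitzWith_comp_sigmoid hφ).lipschitzOnWith (s := Set.Icc (-A.Qx Bx) (A.Qx Bx))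
  have hψσ := (lipschitzWith_comp_sigmoid hψ).lipschitzOnWith (s := Set.Icc (-A.Qz Bz) (A.Qz Bz))
  have hbound := errorBoundWithFailure_of_integral_uniformDev_le hBx hBz hX hZ
    (continuousOn_of_lipschitzOnWith_neg hφ hψ) hωs hn hm hδ hδ1 hφσ hψσ
    ((isScoreFamily_preact (nonneg_of_ae_norm_le hBx) hBx).integral_uniformDev_comp_le hφσ hn)
    ((isScoreFamily_preact_gen (nonneg_of_ae_norm_le hBz) hBz).integral_uniformDev_comp_le hψσ hm)
  rwa [quarter_deviation_eq] at hbound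

theorem errorBoundWithFailure_of_lipschitzOnWith
    (hBx : ∀ᵐ x ∂Pr, ‖x‖ ≤ Bx) (hBz : ∀ᵐ z ∂PZ, ‖z‖ ≤ Bz)
    (hX : HasLaw (fun t i => X i t) (Measure.pi fun _ => Pr) μ)
    (hZ : HasLaw (fun t j => Z j t) (Measure.pi fun _ => PZ) μ)
    (hωs : ∀ θ ∈ A.genSet, ωs θ ∈ A.discSet) (hn : 0 < n) (hm : 0 < m)
    (hδ : 0 < δ) (hδ1 : δ ≤ 1) {Lφ Lψ : ℝ≥0}
    (hφ : LipschitzOnWith Lφ (fun t => -ℓG 1 t) (Set.Ioo 0 1))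
    (hψ : LipschitzOnWith Lψ (fun t => -ℓG 0 t) (Set.Ioo 0 1)) :
    ErrorBoundWithFailure μ ℓG ωs Pr PZ X Z (2 * δ)
      (Lφ * A.Qx Bx * √(3 * ((A.K : ℝ) + 1)) / √n
        + Lψ * A.Qz Bz * √(3 * ((A.K : ℝ) + 1 + (A.L + 1) - 1)) / √m
        + √(Real.log (1 / δ)) * (Lφ * A.Qx Bx / √(2 * n) + Lψ * A.Qz Bz / √(2 * m))) := by
  have hbound := errorBoundWithFailure_of_lipschitzOnWith_comp_sigmoid hBx hBz hX hZ
    (continuousOn_of_lipschitzOnWith_neg hφ hψ) hωs hn hm hδ hδ1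
    (lipschitzWith_comp_sigmoid hφ).lipschitzOnWith (lipschitzWith_comp_sigmoid hψ).lipschitzOnWith
  rw [quarter_deviation_eq] at hbound
  convert hbound using 2
  push_cast
  ring

theorem errorBoundWithFailure_alphaLoss
    (hBx : ∀ᵐ x ∂Pr, ‖x‖ ≤ Bx) (hBz : ∀ᵐ z ∂PZ, ‖z‖ ≤ Bz)
    (hX : HasLaw (fun t i => X i t) (Measure.pi fun _ => Pr) μ)
    (hZ : HasLaw (fun t j => Z j t) (Measure.pi fun _ => PZ) μ)
    (hωs : ∀ θ ∈ A.genSet, ωs θ ∈ A.discSet) (hn : 0 < n) (hm : 0 < m)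
    (hδ : 0 < δ) (hδ1 : δ ≤ 1) {α : ℝ≥0∞} (hα : 0 < α) :
    ErrorBoundWithFailure μ (alphaLoss α) ωs Pr PZ X Z (2 * δ)
      (4 * clipConst α (A.Qx Bx) * A.Qx Bx * √(3 * ((A.K : ℝ) + 1)) / √n
        + 4 * clipConst α (A.Qz Bz) * A.Qz Bz * √(3 * ((A.K : ℝ) + 1 + (A.L + 1) - 1)) / √m
        + 2 * √(2 * Real.log (1 / δ))
          * (clipConst α (A.Qx Bx) * A.Qx Bx / √n + clipConst α (A.Qz Bz) * A.Qz Bz / √m)) := by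
  have hbound := errorBoundWithFailure_of_lipschitzOnWith_comp_sigmoid hBx hBz hX hZ
    (continuousOn_alphaLoss hα) hωs hn hm hδ hδ1
    (lipschitzOnWith_neg_alphaLoss_sigmoid hα _ 1) (lipschitzOnWith_neg_alphaLoss_sigmoid hα _ 0)
  rw [NNReal.coe_mk, NNReal.coe_mk] at hbound
  convert hbound using 1
  ring

end HighProbability

end DualGAN

open DualGAN DualGAN.Arch in
theorem mainTheorem12_general (A : DualGAN.Arch)
    (Pr : Measure A.Data) [IsProbabilityMeasure Pr]
    (PZ : Measure A.Latent) [IsProbabilityMeasure PZ]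
    (Bx Bz : ℝ) (hBx : ∀ᵐ x ∂Pr, ‖x‖ ≤ Bx) (hBz : ∀ᵐ z ∂PZ, ‖z‖ ≤ Bz)
    (n m : ℕ) (hn : 0 < n) (hm : 0 < m)
    {S : Type*} [MeasurableSpace S] (μ : Measure S)
    (X : Fin n → S → A.Data) (hX : ∀ i, HasLaw (X i) Pr μ) (hXind : iIndepFun X μ)
    (Z : Fin m → S → A.Latent) (hZ : ∀ j, HasLaw (Z j) PZ μ) (hZind : iIndepFun Z μ)
    (ωs : A.GParam → A.DParam) (hωs : ∀ θ ∈ A.genSet, ωs θ ∈ A.discSet) :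
    (∀ ℓG : Fin 2 → ℝ → ℝ,
      (∀ y, ContinuousOn (ℓG y) (Set.Ioo 0 1)) →
      ∀ x : Fin n → A.Data, (∀ i, ‖x i‖ ≤ Bx) →
      ∀ z : Fin m → A.Latent, (∀ j, ‖z j‖ ≤ Bz) →
      ∀ θ, IsTrainedGen ℓG ωs x z θ →
        estError ℓG ωs Pr PZ θ
          ≤ 2 * uniformDev Pr (discFamily A fun t => -ℓG 1 t) x
            + 2 * uniformDev PZ (discGenFamily A fun t => -ℓG 0 t) z)
    ∧ (∀ (ℓG : Fin 2 → ℝ → ℝ) (Lφ Lψ : ℝ≥0),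
      LipschitzOnWith Lφ (fun t => -ℓG 1 t) (Set.Ioo 0 1) →
      LipschitzOnWith Lψ (fun t => -ℓG 0 t) (Set.Ioo 0 1) →
      ∀ δ : ℝ, 0 < δ → δ ≤ 1 →
        ErrorBoundWithFailure μ ℓG ωs Pr PZ X Z (2 * δ)
          (4 * rademacher Pr (discFamily A fun t => -ℓG 1 t) n
            + 4 * rademacher PZ (discGenFamily A fun t => -ℓG 0 t) m
            + √(Real.log (1 / δ))
              * (Lφ * A.Qx Bx / √(2 * n) + Lψ * A.Qz Bz / √(2 * m)))
        ∧ ErrorBoundWithFailure μ ℓG ωs Pr PZ X Z (2 * δ)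
          (Lφ * A.Qx Bx * √(3 * ((A.K : ℝ) + 1)) / √n
            + Lψ * A.Qz Bz * √(3 * ((A.K : ℝ) + 1 + (A.L + 1) - 1)) / √m
            + √(Real.log (1 / δ))
              * (Lφ * A.Qx Bx / √(2 * n) + Lψ * A.Qz Bz / √(2 * m))))
    ∧ (∀ αG : ℝ≥0∞, 0 < αG →
      ∀ δ : ℝ, 0 < δ → δ ≤ 1 →
        ErrorBoundWithFailure μ (alphaLoss αG) ωs Pr PZ X Z (2 * δ)
          (4 * clipConst αG (A.Qx Bx) * A.Qx Bx * √(3 * ((A.K : ℝ) + 1)) / √n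
            + 4 * clipConst αG (A.Qz Bz) * A.Qz Bz
                * √(3 * ((A.K : ℝ) + 1 + (A.L + 1) - 1)) / √m
            + 2 * √(2 * Real.log (1 / δ))
              * (clipConst αG (A.Qx Bx) * A.Qx Bx / √n
                + clipConst αG (A.Qz Bz) * A.Qz Bz / √m))) := by
  have hXlaw := hXind.hasLaw_pi hX
  have hZlaw := hZind.hasLaw_pi hZ
  refine ⟨fun ℓG hℓ x hx z hz θ hθ => estError_le_uniformDev hBx hBz hℓ hωs hx hz hθ,
    fun ℓG Lφ Lψ hφ hψ δ hδ hδ1 => ⟨?rademacher, ?network⟩,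
    fun αG hαG δ hδ hδ1 => errorBoundWithFailure_alphaLoss hBx hBz hXlaw hZlaw hωs hn hm hδ hδ1 hαG⟩
  case rademacher =>
    exact errorBoundWithFailure_rademacher_of_lipschitzOnWith hBx hBz hXlaw hZlaw hωs hn hm hδ hδ1
      hφ hψ
  case network =>
    exact errorBoundWithFailure_of_lipschitzOnWith hBx hBz hXlaw hZlaw hωs hn hm hδ hδ1 hφ hψ

open DualGAN DualGAN.Arch in
theorem mainTheorem12 (A : DualGAN.Arch)
    (Pr : Measure A.Data) [IsProbabilityMeasure Pr]
    (PZ : Measure A.Latent) [IsProbabilityMeasure PZ]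
    (Bx Bz : ℝ) (hBx : ∀ᵐ x ∂Pr, ‖x‖ ≤ Bx) (hBz : ∀ᵐ z ∂PZ, ‖z‖ ≤ Bz)
    (n m : ℕ) (hn : 0 < n) (hm : 0 < m)
    {S : Type*} [MeasurableSpace S] (μ : Measure S) [IsProbabilityMeasure μ]
    (X : Fin n → S → A.Data) (hX : ∀ i, HasLaw (X i) Pr μ) (hXind : iIndepFun X μ)
    (Z : Fin m → S → A.Latent) (hZ : ∀ j, HasLaw (Z j) PZ μ) (hZind : iIndepFun Z μ) :
    -- the estimation error is bounded by the uniform deviations, for every pair of samples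
    (∀ (ℓD ℓG : Fin 2 → ℝ → ℝ),
      (∀ y, ContinuousOn (ℓG y) (Set.Ioo 0 1)) →
      ∀ ωs : A.GParam → A.DParam, IsOptimalDisc ℓD Pr PZ ωs →
      ∀ x : Fin n → A.Data, (∀ i, ‖x i‖ ≤ Bx) →
      ∀ z : Fin m → A.Latent, (∀ j, ‖z j‖ ≤ Bz) →
      ∀ θ, IsTrainedGen ℓG ωs x z θ →
        estError ℓG ωs Pr PZ θ
          ≤ 2 * uniformDev Pr (discFamily A fun t => -ℓG 1 t) x
            + 2 * uniformDev PZ (discGenFamily A fun t => -ℓG 0 t) z)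
    -- high-probability bounds for Lipschitz losses
    ∧ (∀ (ℓD ℓG : Fin 2 → ℝ → ℝ) (Lφ Lψ : ℝ≥0),
      LipschitzOnWith Lφ (fun t => -ℓG 1 t) (Set.Ioo 0 1) →
      LipschitzOnWith Lψ (fun t => -ℓG 0 t) (Set.Ioo 0 1) →
      ∀ ωs : A.GParam → A.DParam, IsOptimalDisc ℓD Pr PZ ωs →
      ∀ δ : ℝ, 0 < δ → δ < 1 →
        ErrorBoundWithFailure μ ℓG ωs Pr PZ X Z (2 * δ)
          (4 * rademacher Pr (discFamily A fun t => -ℓG 1 t) n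
            + 4 * rademacher PZ (discGenFamily A fun t => -ℓG 0 t) m
            + √(Real.log (1 / δ))
              * (Lφ * A.Qx Bx / √(2 * n) + Lψ * A.Qz Bz / √(2 * m)))
        ∧ ErrorBoundWithFailure μ ℓG ωs Pr PZ X Z (2 * δ)
          (Lφ * A.Qx Bx * √(3 * ((A.K : ℝ) + 1)) / √n
            + Lψ * A.Qz Bz * √(3 * ((A.K : ℝ) + 1 + (A.L + 1) - 1)) / √m
            + √(Real.log (1 / δ))
              * (Lφ * A.Qx Bx / √(2 * n) + Lψ * A.Qz Bz / √(2 * m))))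
    -- specialization to the tunable losses of the discriminator and of the generator
    ∧ (∀ αD αG : ℝ≥0∞, 0 < αD → 0 < αG →
      ∀ ωs : A.GParam → A.DParam, IsOptimalDisc (alphaLoss αD) Pr PZ ωs →
      ∀ δ : ℝ, 0 < δ → δ < 1 →
        ErrorBoundWithFailure μ (alphaLoss αG) ωs Pr PZ X Z (2 * δ)
          (4 * clipConst αG (A.Qx Bx) * A.Qx Bx * √(3 * ((A.K : ℝ) + 1)) / √n
            + 4 * clipConst αG (A.Qz Bz) * A.Qz Bz
                * √(3 * ((A.K : ℝ) + 1 + (A.L + 1) - 1)) / √m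
            + 2 * √(2 * Real.log (1 / δ))
              * (clipConst αG (A.Qx Bx) * A.Qx Bx / √n
                + clipConst αG (A.Qz Bz) * A.Qz Bz / √m))) := by
  have h {ℓD ωs} (hωs : IsOptimalDisc ℓD Pr PZ ωs) := mainTheorem12_general A Pr PZ Bx Bz hBx hBz
    n m hn hm μ X hX hXind Z hZ hZind ωs fun θ hθ => (hωs θ hθ).1
  exact ⟨fun _ ℓG hℓ ωs hωs => (h hωs).1 ℓG hℓ,
    fun _ ℓG Lφ Lψ hφ hψ ωs hωs δ hδ hδ1 => (h hωs).2.1 ℓG Lφ Lψ hφ hψ δ hδ hδ1.le,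
    fun _ αG _ hαG ωs hωs δ hδ hδ1 => (h hωs).2.2 αG hαG δ hδ hδ1.le⟩
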